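/- **Setting.** Let $n\ge 2$, let $C\in\mathbb R_+^{n\times n}$, and let $p,q$ be probability vectors in $\mathbb R^n$. Put $\mathcal U(p,q)=\{\pi\in\mathbb R_+^{n\times n}:\pi\mathbf 1=p,\ \pi^T\mathbf 1=q\}$, $\langle C,\pi\rangle=\sum_{i,j}C_{ij}\pi_{ij}$, $\|C\|_\infty=\max_{i,j}|C_{ij}|$, $KL(\pi|\rho)=\sum_{i,j}\pi_{ij}\ln(\pi_{ij}/\rho_{ij})$ (terms with $\pi_{ij}=0$ are $0$). A plan $\pi\in\mathcal U(p,q)$ is $\varepsilon$-optimal if $\langle C,\pi\rangle\le\min_{\pi'\in\mathcal U(p,q)}\langle C,\pi'\rangle+\varepsilon$. For $L>0$ and a plan $\rho$ let $\phi_\rho(\pi)=\langle C,\pi\rangle+L\cdot KL(\pi|\rho)$. A point $x\in Q$ minimizes $\phi$ over $Q$ with $\delta$-precision if $\phi$ is differentiable at $x$ and $\max_{y\in Q}\langle\nabla\phi(x),x-y\rangle\le\delta$; it minimizes $\phi$ over $Q$ with objective residual $\delta$ if $\phi(x)\le\min_Q\phi+\delta$. *Sinkhorn's algorithm* (for $p,q$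 with positive entries) with cost matrix $M$, parameter $\gamma>0$ and accuracy $\tilde\varepsilon$: let $K=e^{-M/\gamma}$ entrywise, $B(u,v)=\mathrm{diag}(e^u)K\,\mathrm{diag}(e^v)$, $u^0=\ln p$, $v^0=\ln q$, $\varepsilon'=\frac{\tilde\varepsilon}{4}\big(\max M-\min M+2\gamma\ln\frac{4\gamma n^2}{\tilde\varepsilon}\big)^{-1}$. At even $t$ set $u^{t+1}=u^t+\ln p-\ln(B(u^t,v^t)\mathbf 1)$, $v^{t+1}=v^t$; at odd $t$ set $v^{t+1}=v^t+\ln q-\ln(B(u^t,v^t)^T\mathbf 1)$, $u^{t+1}=u^t$. Stop at the first $t\ge1$ with $\|B(u^t,v^t)\mathbf 1-p\|_1+\|B(u^t,v^t)^T\mathbf 1-q\|_1\le\varepsilon'$, and return the following rounding of $B=B(u^t,v^t)$ to $\mathcal U(p,q)$: $F_1=\mathrm{diag}(\min\{p/(B\mathbf 1),1\})B$, $F_2=F_1\mathrm{diag}(\min\{q/(F_1^T\mathbf 1),1\})$, $a=p-F_2\mathbf 1$, $b=q-F_2^T\mathbf 1$, $\hat\pi=F_2+ab^T/\|a\|_1$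 ($\hat\pi=F_2$ if $a=0$). The *inner solve at $\rho$* is this algorithm with $M=C-L\ln\rho$, $\gamma=L$, that is, $K=\rho\odot e^{-C/L}$; its cost is the number of arithmetic operations ($+,-,\cdot,/,\exp,\ln,|\cdot|,\min,\max$, comparison), the computation of $M$ included. **Theorem.** 1. *(Outer iterations.)* Let $L,\varepsilon>0$, and let $N$ be an integer with $N\ge\frac{4L\ln n}{\varepsilon}$. Let $\pi^0=pq^T$, and for $0\le k<N$ let $\pi^{k+1}$ minimize $\phi_{\pi^k}$ over $\mathcal U(p,q)$ with $\frac\varepsilon2$-precision. Then $\bar\pi^N=\frac1N\sum_{k=1}^N\pi^k$ is $\varepsilon$-optimal. 2. *(Inner accuracy.)* There are absolute constants $c>0$ and $r\in\mathbb N$ such that the following holds whenever $0<\varepsilon\le 4L\ln n$, $\varepsilon^3\le Ln^4$ and $0<\tilde\varepsilon\le\frac{c}{(\ln n)^r}\cdot\frac{\varepsilon^4}{Ln^4}$. (a) Let $p,q$ have positive entries. For every entrywise positive $\rho\in\mathcal U(p,q)$ the inner solve at $\rho$ with accuracy $\tilde\varepsilon$ terminates, and its output is entrywise positive and minimizes $\phi_\rho$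 over $\mathcal U(p,q)$ with objective residual $\tilde\varepsilon$ and also with $\frac\varepsilon2$-precision. Consequently, if $\pi^0=pq^T$ and $\pi^{k+1}$ is the output of the inner solve at $\pi^k$ for $k<N$, $N\ge\frac{4L\ln n}\varepsilon$, then the $\pi^k$ are iterates as in part 1, and $\bar\pi^N$ is $\varepsilon$-optimal. (b) Let $Q=\{\pi\in\mathcal U(p,q):\pi_{ij}\ge\frac{\varepsilon}{4n^2}\ \forall i,j\}$. If $\pi^0=pq^T$ and, for $k<N$ with $N\ge\frac{4L\ln n}\varepsilon$, $\pi^{k+1}$ is any minimizer of $\phi_{\pi^k}$ over $Q$ with objective residual $\tilde\varepsilon$, then each $\pi^{k+1}$ minimizes $\phi_{\pi^k}$ over $Q$ with $\frac\varepsilon2$-precision, and $\bar\pi^N$ is $(1+\|C\|_\infty)\varepsilon$-optimal. 3. *(Cost of an inner solve.)* There are absolute constants $A>0$ and $r\in\mathbb N$ such that the following holds. Let $p,q$ have positive entries, let $\pi^k\in\mathcal U(p,q)$ be entrywise positive, $L>0$, $0<\tilde\varepsilon<4Ln^2$, and $\bar c_k=\|C\|_\infty+L\ln\frac{\max_{i,j}\pi^k_{ij}}{\min_{i,j}\pi^k_{ij}}$.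 Then the inner solve at $\pi^k$ with accuracy $\tilde\varepsilon$ terminates after at most $$A(\ln n)^r\Big(1+\min\Big\{e^{\bar c_k/L}\Big(\frac{\bar c_k}{L}+\max\Big\{0,\ln\frac{\bar c_k}{\tilde\varepsilon}\Big\}\Big),\ \frac{\bar c_k^2}{L\tilde\varepsilon}\Big\}\Big)$$ Sinkhorn iterations, and its cost is at most $n^2$ times this quantity (for $\bar c_k=0$ the logarithmic term is read as $0$). -/

import Mathlib

noncomputable section

namespace ProxSinkhorn

/-! ### Transport plans, the optimal transport problem and inexact minimizers -/

/-- An `n × n` real matrix. Its norm (the sup norm of the product) is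
`‖C‖_∞ = max_{i,j} |C i j|`. -/
abbrev Plan (n : ℕ) : Type := Fin n → Fin n → ℝ

variable {n : ℕ}

/-- The Frobenius product `⟨C, π⟩`. -/
def cost (C π : Plan n) : ℝ := ∑ i, ∑ j, C i j * π i j

/-- The transport polytope `U(p, q)`. -/
def polytope (p q : Fin n → ℝ) : Set (Plan n) :=
  {π | (∀ i j, 0 ≤ π i j) ∧ (∀ i, ∑ j, π i j = p i) ∧ (∀ j, ∑ i, π i j = q j)}

/-- The plans of `U(p, q)` all of whose entries are at least `s`. -/
def truncatedPolytope (p q : Fin n → ℝ) (s : ℝ) : Set (Plan n) :=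
  {π | π ∈ polytope p q ∧ ∀ i j, s ≤ π i j}

/-- `π` is a transport plan whose cost exceeds the minimal one by at most `ε`. -/
def IsEpsOptimal (C : Plan n) (p q : Fin n → ℝ) (ε : ℝ) (π : Plan n) : Prop :=
  π ∈ polytope p q ∧ ∃ m, IsLeast (cost C '' polytope p q) m ∧ cost C π ≤ m + ε

/-- The Kullback-Leibler divergence `KL(π | ρ) = ∑ π_{ij} ln (π_{ij} / ρ_{ij})`. A term with
`π_{ij} = 0` is zero; entries with `ρ_{ij} = 0` only occur where `p_i q_j = 0`, and there every
plan of `U(p, q)` vanishes. -/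
def planKL (π ρ : Plan n) : ℝ := ∑ i, ∑ j, π i j * Real.log (π i j / ρ i j)

/-- The objective `⟨C, π⟩ + L · KL(π | ρ)` of one proximal step from `ρ`. -/
def proxObjective (C : Plan n) (L : ℝ) (ρ π : Plan n) : ℝ := cost C π + L * planKL π ρ

/-- `x` minimizes the smooth function `φ` over `Q` with `δ`-precision:
`max_{y ∈ Q} ⟨∇φ(x), x - y⟩ ≤ δ`. -/
def IsInexactMin {E : Type*} [NormedAddCommGroup E] [NormedSpace ℝ E]
    (Q : Set E) (φ : E → ℝ) (δ : ℝ) (x : E) : Prop :=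
  x ∈ Q ∧ DifferentiableAt ℝ φ x ∧ ∀ y ∈ Q, fderiv ℝ φ x (x - y) ≤ δ

/-- `x` minimizes `φ` over `Q` up to the objective residual `ε`. -/
def IsResidualMin {E : Type*} (Q : Set E) (φ : E → ℝ) (ε : ℝ) (x : E) : Prop :=
  x ∈ Q ∧ ∀ y ∈ Q, φ x ≤ φ y + ε

/-- The independent coupling `p qᵀ`. -/
def productPlan (p q : Fin n → ℝ) : Plan n := fun i j => p i * q j

/-- `π 0, …, π N` are outer iterates: `π 0 = p qᵀ` and each `π (k+1)` is a minimizer, with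
`δ`-precision, of `⟨C, ·⟩ + L · KL(· | π k)` over `U(p, q)`. -/
def IsProxIterates (C : Plan n) (p q : Fin n → ℝ) (L δ : ℝ) (N : ℕ) (π : ℕ → Plan n) : Prop :=
  π 0 = productPlan p q ∧
    ∀ k < N, IsInexactMin (polytope p q) (proxObjective C L (π k)) δ (π (k + 1))

/-- The average `(1/N) ∑_{k=1}^N π k`. -/
def averagePlan (π : ℕ → Plan n) (N : ℕ) : Plan n := (N : ℝ)⁻¹ • ∑ k ∈ Finset.Icc 1 N, π k

/-- The largest entry. -/
def maxEntry (M : Plan n) : ℝ := ⨆ i, ⨆ j, M i j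

/-- The smallest entry. -/
def minEntry (M : Plan n) : ℝ := ⨅ i, ⨅ j, M i j

/-- `c̄ = ‖C‖_∞ + L ln (max ρ / min ρ)`. -/
def cBar (C : Plan n) (L : ℝ) (ρ : Plan n) : ℝ :=
  ‖C‖ + L * Real.log (maxEntry ρ / minEntry ρ)

/-! ### Computations with a count of the arithmetic operations

Each of the operations `+, -, *, /, exp, ln, |·|, min, max, ≤` on real numbers costs one unit. -/

/-- A value together with the number of real operations spent on computing it. -/
structure Timed (α : Type) where
  val : α
  ops : ℕ

namespace Timed

instance : Monad Timed where
  pure a := ⟨a, 0⟩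
  bind x f := ⟨(f x.val).val, x.ops + (f x.val).ops⟩

def add (x y : ℝ) : Timed ℝ := ⟨x + y, 1⟩
def sub (x y : ℝ) : Timed ℝ := ⟨x - y, 1⟩
def mul (x y : ℝ) : Timed ℝ := ⟨x * y, 1⟩
def div (x y : ℝ) : Timed ℝ := ⟨x / y, 1⟩
def exp (x : ℝ) : Timed ℝ := ⟨Real.exp x, 1⟩
def log (x : ℝ) : Timed ℝ := ⟨Real.log x, 1⟩
def abs (x : ℝ) : Timed ℝ := ⟨|x|, 1⟩
def min (x y : ℝ) : Timed ℝ := ⟨x ⊓ y, 1⟩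
def le (x y : ℝ) : Timed Prop := ⟨x ≤ y, 1⟩

/-- Compute and store a vector, entry by entry. -/
def vec {α : Type} (f : Fin n → Timed α) : Timed (Fin n → α) :=
  ⟨fun i => (f i).val, ∑ i, (f i).ops⟩

/-- Compute and store a matrix, entry by entry. -/
def mat (f : Fin n → Fin n → Timed ℝ) : Timed (Plan n) := vec fun i => vec (f i)

/-- Compute the summands and add them up. -/
def sum (f : Fin n → Timed ℝ) : Timed ℝ := ⟨∑ i, (f i).val, ∑ i, ((f i).ops + 1)⟩

/-- Maximum of the entries of a matrix, one comparison for each entry. -/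
def maxEntry (M : Plan n) : Timed ℝ := ⟨ProxSinkhorn.maxEntry M, n * n⟩

/-- Minimum of the entries of a matrix, one comparison for each entry. -/
def minEntry (M : Plan n) : Timed ℝ := ⟨ProxSinkhorn.minEntry M, n * n⟩

end Timed

/-- Big-step semantics of the loop `repeat s := body t s; t := t + 1 until test s`.
`RepeatUntil body test t s t' s' k` says that the loop, entered with counter `t` and state `s`,
is left with counter `t'` and state `s'` after `k` operations. -/
inductive RepeatUntil {σ : Type} (body : ℕ → σ → Timed σ) (test : σ → Timed Prop) :
    ℕ → σ → ℕ → σ → ℕ → Prop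
  | exit (t : ℕ) (s : σ) (h : (test (body t s).val).val) :
      RepeatUntil body test t s (t + 1) (body t s).val
        ((body t s).ops + (test (body t s).val).ops)
  | again (t : ℕ) (s : σ) (t' : ℕ) (s' : σ) (k : ℕ) (h : ¬ (test (body t s).val).val)
      (hk : RepeatUntil body test (t + 1) (body t s).val t' s' k) :
      RepeatUntil body test t s t' s'
        ((body t s).ops + (test (body t s).val).ops + k)

/-! ### Sinkhorn's algorithm -/

/-- The pair `(u, v)` of scaling vectors. -/
abbrev Potentials (n : ℕ) : Type := (Fin n → ℝ) × (Fin n → ℝ)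

/-- `K = exp (-M / γ)`, entrywise. -/
def gibbsKernel (M : Plan n) (γ : ℝ) : Timed (Plan n) :=
  Timed.mat fun i j => do
    let x ← Timed.sub 0 (M i j)
    let y ← Timed.div x γ
    Timed.exp y

/-- The stopping threshold
`ε' = (ε̃ / 4) / (max M - min M + 2 γ ln (4 γ n² / ε̃))`. -/
def threshold (M : Plan n) (γ εt : ℝ) : Timed ℝ := do
  let hi ← Timed.maxEntry M
  let lo ← Timed.minEntry M
  let range ← Timed.sub hi lo
  let n2 ← Timed.mul n n
  let g4 ← Timed.mul 4 γ
  let a ← Timed.mul g4 n2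
  let b ← Timed.div a εt
  let l ← Timed.log b
  let g2 ← Timed.mul 2 γ
  let d ← Timed.mul g2 l
  let denom ← Timed.add range d
  let num ← Timed.div εt 4
  Timed.div num denom

/-- `B(u, v) = diag(e^u) K diag(e^v)`. -/
def scaledKernel (K : Plan n) (s : Potentials n) : Timed (Plan n) := do
  let a ← Timed.vec fun i => Timed.exp (s.1 i)
  let b ← Timed.vec fun j => Timed.exp (s.2 j)
  Timed.mat fun i j => do
    let x ← Timed.mul (a i) (K i j)
    Timed.mul x (b j)

/-- The row sums `B 1`. -/
def rowSums (B : Plan n) : Timed (Fin n → ℝ) := Timed.vec fun i => Timed.sum fun j => pure (B i j)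

/-- The column sums `Bᵀ 1`. -/
def colSums (B : Plan n) : Timed (Fin n → ℝ) := Timed.vec fun j => Timed.sum fun i => pure (B i j)

/-- The update `w + ln p - ln r`, entrywise. -/
def logUpdate (w p r : Fin n → ℝ) : Timed (Fin n → ℝ) :=
  Timed.vec fun i => do
    let a ← Timed.log (p i)
    let b ← Timed.log (r i)
    let c ← Timed.add (w i) a
    Timed.sub c b

/-- Iteration number `t`: for even `t` the vector `u` is updated, for odd `t` the vector `v`. -/
def sinkhornStep (K : Plan n) (p q : Fin n → ℝ) (t : ℕ) (s : Potentials n) :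
    Timed (Potentials n) := do
  let B ← scaledKernel K s
  if t % 2 = 0 then
    let r ← rowSums B
    let u ← logUpdate s.1 p r
    pure (u, s.2)
  else
    let c ← colSums B
    let v ← logUpdate s.2 q c
    pure (s.1, v)

/-- The `ℓ₁` distance of two vectors. -/
def distL1 (x y : Fin n → ℝ) : Timed ℝ :=
  Timed.sum fun i => do
    let d ← Timed.sub (x i) (y i)
    Timed.abs d

/-- The stopping test `‖B 1 - p‖₁ + ‖Bᵀ 1 - q‖₁ ≤ ε'`. -/
def sinkhornTest (K : Plan n) (p q : Fin n → ℝ) (ε' : ℝ) (s : Potentials n) : Timed Prop := do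
  let B ← scaledKernel K s
  let r ← rowSums B
  let c ← colSums B
  let x ← distL1 r p
  let y ← distL1 c q
  let e ← Timed.add x y
  Timed.le e ε'

/-- Rounding of a nonnegative matrix `F` to `U(p, q)`: rows, then columns, are scaled down where
their sums are too large, and a rank-one matrix repairs the missing mass (nothing is added when no
mass is missing, since then both error vectors are zero). -/
def roundPlan (p q : Fin n → ℝ) (F : Plan n) : Timed (Plan n) := do
  let r ← rowSums F
  let x ← Timed.vec fun i => do
    let a ← Timed.div (p i) (r i)
    Timed.min a 1
  let F₁ ← Timed.mat fun i j => Timed.mul (x i) (F i j)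
  let c ← colSums F₁
  let y ← Timed.vec fun j => do
    let a ← Timed.div (q j) (c j)
    Timed.min a 1
  let F₂ ← Timed.mat fun i j => Timed.mul (F₁ i j) (y j)
  let r₂ ← rowSums F₂
  let c₂ ← colSums F₂
  let errR ← Timed.vec fun i => Timed.sub (p i) (r₂ i)
  let errC ← Timed.vec fun j => Timed.sub (q j) (c₂ j)
  let m ← Timed.sum fun i => Timed.abs (errR i)
  Timed.mat fun i j => do
    let a ← Timed.mul (errR i) (errC j)
    let b ← Timed.div a m
    Timed.add (F₂ i j) b

/-- What is computed before the loop: `K`, `ε'`, `u⁰ = ln p` and `v⁰ = ln q`. -/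
def sinkhornSetup (M : Plan n) (γ εt : ℝ) (p q : Fin n → ℝ) :
    Timed (Plan n × ℝ × Potentials n) := do
  let K ← gibbsKernel M γ
  let ε' ← threshold M γ εt
  let u ← Timed.vec fun i => Timed.log (p i)
  let v ← Timed.vec fun j => Timed.log (q j)
  pure (K, ε', (u, v))

/-- What is computed after the loop. -/
def sinkhornFinish (K : Plan n) (p q : Fin n → ℝ) (s : Potentials n) : Timed (Plan n) := do
  let B ← scaledKernel K s
  roundPlan p q B

/-- Sinkhorn's algorithm with cost matrix `M`, regularization `γ`, accuracy `εt` and marginals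
`p`, `q` stops after `T` iterations, returns `πhat`, and spends `k` operations in all. -/
def SinkhornRun (M : Plan n) (γ εt : ℝ) (p q : Fin n → ℝ) (πhat : Plan n) (T k : ℕ) : Prop :=
  ∃ (s : Potentials n) (kLoop : ℕ),
    RepeatUntil
      (sinkhornStep (sinkhornSetup M γ εt p q).val.1 p q)
      (sinkhornTest (sinkhornSetup M γ εt p q).val.1 p q (sinkhornSetup M γ εt p q).val.2.1)
      0 (sinkhornSetup M γ εt p q).val.2.2 T s kLoop ∧
    πhat = (sinkhornFinish (sinkhornSetup M γ εt p q).val.1 p q s).val ∧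
    k = (sinkhornSetup M γ εt p q).ops + kLoop +
      (sinkhornFinish (sinkhornSetup M γ εt p q).val.1 p q s).ops

/-- The cost matrix `C - L ln ρ` of the proximal step from `ρ`; with `γ = L` its kernel
`exp (-M / γ)` is `ρ ⊙ exp (-C / L)`. -/
def proxCost (C : Plan n) (L : ℝ) (ρ : Plan n) : Timed (Plan n) :=
  Timed.mat fun i j => do
    let l ← Timed.log (ρ i j)
    let x ← Timed.mul L l
    Timed.sub (C i j) x

/-- One inner solve: Sinkhorn's algorithm, run with accuracy `εt` for the minimization of
`⟨C, π⟩ + L · KL(π | ρ)` over `U(p, q)`, stops after `T` iterations, returns `πhat`, and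
spends `k` operations in all, the computation of `C - L ln ρ` included. -/
def InnerSolve (C : Plan n) (L εt : ℝ) (p q : Fin n → ℝ) (ρ πhat : Plan n) (T k : ℕ) : Prop :=
  ∃ k', SinkhornRun (proxCost C L ρ).val L εt p q πhat T k' ∧ k = (proxCost C L ρ).ops + k'

/-- The factor in the bound for the cost of an inner solve:
`1 + min { exp(c̄/L) (c̄/L + ln⁺(c̄/ε̃)), c̄² / (L ε̃) }`. -/
def innerRate (c L εt : ℝ) : ℝ :=
  1 + min (Real.exp (c / L) * (c / L + max 0 (Real.log (c / εt)))) (c ^ 2 / (L * εt))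

end ProxSinkhorn

end

open ProxSinkhorn

/-! Outer iterations. Test the precision condition at `π (k+1)` against a fixed plan `y`. Since
`KL(π (k+1) | π k) ≥ 0`, the cost excess over `y` is at most `δ + L ∑ y (ln π (k+1) - ln π k)`
(`cost_sub_le_of_isInexactMin`). The sum over `k` telescopes. The last logarithm is nonpositive and
the initial one contributes the entropies of `p` and `q`, at most `2 L ln n` in all, so averaging
leaves `δ + 2 L ln n / N` (`cost_averagePlan_le`).

Truncated problems. On plans with entries at least `s` the divergence has a quadratic upper bound
with constant `1/s`, so a short step towards `y` turns an objective residual into precision.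
Restricting to such plans costs at most `2 s n² ‖C‖` (`exists_mem_truncatedPolytope_cost_le`).

Sinkhorn. The two scaling vectors interlace into one sequence in which `x (t+1)` is a soft-min
transform of `x t`; one marginal is always exact and `scalingError` is the defect of the other. Let
`R` bound the oscillation of the cost divided by `γ`. Two rates hold: - linear: the transform
contracts oscillations by `1 - exp (-R)` (`softPot_sub_sub_le`, `error_le`); - sublinear: an
iteration raises the dual value by at least `err²/4`, while no later value exceeds the current one
by more than `2 R err` (`error_sq_le`, `dual_sub_le`, `exists_error_le`). `iterations_le` plays them
against each other, so that no stray logarithm of the accuracy survives in the second bound.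

Accuracy. If `B` is the final scaled kernel, the objective on the polytope equals `L KL(· | B)` plus
a constant. Residual and precision are thus controlled by `∑ x ln (x/B)` and `∑ y ln (B/x)` for the
rounded plan `x`. `roundCols_spec` bounds both through the marginal error, without the smallest
entry of `p` or `q`. -/

namespace ProxSinkhorn

/-! ### Values and operation counts of the programs -/

variable {n : ℕ}

lemma proxCost_val (C : Plan n) (L : ℝ) (ρ : Plan n) :
    (proxCost C L ρ).val = fun i j => C i j - L * Real.log (ρ i j) := rfl

lemma proxCost_ops (C : Plan n) (L : ℝ) (ρ : Plan n) : (proxCost C L ρ).ops = 3 * n ^ 2 := by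
  simp only [proxCost, Timed.mat, Timed.vec, bind, Timed.log, Timed.mul, Timed.sub]
  simp
  ring

lemma sinkhornSetup_kernel (M : Plan n) (γ εt : ℝ) (p q : Fin n → ℝ) :
    (sinkhornSetup M γ εt p q).val.1 = fun i j => Real.exp ((0 - M i j) / γ) := rfl

lemma sinkhornSetup_threshold (M : Plan n) (γ εt : ℝ) (p q : Fin n → ℝ) :
    (sinkhornSetup M γ εt p q).val.2.1 =
      εt / 4 / (maxEntry M - minEntry M +
        2 * γ * Real.log (4 * γ * ((n : ℝ) * (n : ℝ)) / εt)) := rfl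

lemma sinkhornSetup_potentials (M : Plan n) (γ εt : ℝ) (p q : Fin n → ℝ) :
    (sinkhornSetup M γ εt p q).val.2.2 =
      (fun i => Real.log (p i), fun j => Real.log (q j)) := rfl

lemma sinkhornSetup_ops_le (hn : 2 ≤ n) (M : Plan n) (γ εt : ℝ) (p q : Fin n → ℝ) :
    (sinkhornSetup M γ εt p q).ops ≤ 20 * n ^ 2 := by
  simp only [sinkhornSetup, gibbsKernel, threshold, Timed.mat, Timed.vec, bind, pure, Timed.log,
    Timed.mul, Timed.sub, Timed.div, Timed.exp, Timed.add, Timed.maxEntry, Timed.minEntry]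
  simp
  nlinarith

lemma scaledKernel_val (K : Plan n) (s : Potentials n) :
    (scaledKernel K s).val = fun i j => Real.exp (s.1 i) * K i j * Real.exp (s.2 j) := rfl

lemma scaledKernel_ops (K : Plan n) (s : Potentials n) :
    (scaledKernel K s).ops = 2 * n + 2 * n ^ 2 := by
  simp only [scaledKernel, Timed.mat, Timed.vec, bind, Timed.exp, Timed.mul]
  simp
  ring

lemma rowSums_ops (B : Plan n) : (rowSums B).ops = n ^ 2 := by
  simp only [rowSums, Timed.vec, Timed.sum, pure]
  simp
  ring

lemma colSums_ops (B : Plan n) : (colSums B).ops = n ^ 2 := by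
  simp only [colSums, Timed.vec, Timed.sum, pure]
  simp
  ring

lemma logUpdate_ops (w p r : Fin n → ℝ) : (logUpdate w p r).ops = 4 * n := by
  simp only [logUpdate, Timed.vec, bind, Timed.log, Timed.add, Timed.sub]
  simp
  ring

lemma distL1_ops (x y : Fin n → ℝ) : (distL1 x y).ops = 3 * n := by
  simp only [distL1, Timed.sum, bind, Timed.abs, Timed.sub]
  simp
  ring

lemma sinkhornStep_val_even (K : Plan n) (p q : Fin n → ℝ) {t : ℕ} (ht : t % 2 = 0)
    (s : Potentials n) :
    (sinkhornStep K p q t s).val =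
      (fun i => s.1 i + Real.log (p i) -
        Real.log (∑ j, Real.exp (s.1 i) * K i j * Real.exp (s.2 j)), s.2) := by
  simp only [sinkhornStep, ht, if_true]
  rfl

lemma sinkhornStep_val_odd (K : Plan n) (p q : Fin n → ℝ) {t : ℕ} (ht : ¬ t % 2 = 0)
    (s : Potentials n) :
    (sinkhornStep K p q t s).val =
      (s.1, fun j => s.2 j + Real.log (q j) -
        Real.log (∑ i, Real.exp (s.1 i) * K i j * Real.exp (s.2 j))) := by
  simp only [sinkhornStep, ht, if_false]
  rfl

lemma sinkhornStep_ops (K : Plan n) (p q : Fin n → ℝ) (t : ℕ) (s : Potentials n) :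
    (sinkhornStep K p q t s).ops = 3 * n ^ 2 + 6 * n := by
  by_cases ht : t % 2 = 0
  · simp only [sinkhornStep, ht, if_true, bind, scaledKernel_ops, rowSums_ops, logUpdate_ops, pure]
    ring
  · simp only [sinkhornStep, ht, if_false, bind, scaledKernel_ops, colSums_ops, logUpdate_ops, pure]
    ring

lemma sinkhornTest_val (K : Plan n) (p q : Fin n → ℝ) (ε' : ℝ) (s : Potentials n) :
    (sinkhornTest K p q ε' s).val ↔
      ∑ i, |∑ j, Real.exp (s.1 i) * K i j * Real.exp (s.2 j) - p i| +
        ∑ j, |∑ i, Real.exp (s.1 i) * K i j * Real.exp (s.2 j) - q j| ≤ ε' := Iff.rfl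

lemma sinkhornTest_ops (K : Plan n) (p q : Fin n → ℝ) (ε' : ℝ) (s : Potentials n) :
    (sinkhornTest K p q ε' s).ops = 4 * n ^ 2 + 8 * n + 2 := by
  simp only [sinkhornTest, bind, scaledKernel_ops, rowSums_ops, colSums_ops, distL1_ops, Timed.add,
    Timed.le]
  ring

lemma roundPlan_ops (p q : Fin n → ℝ) (F : Plan n) :
    (roundPlan p q F).ops = 9 * n ^ 2 + 8 * n := by
  simp only [roundPlan, bind, rowSums_ops, colSums_ops, Timed.vec, Timed.mat, Timed.div, Timed.mul,
    Timed.sub, Timed.add, Timed.abs, Timed.min, Timed.sum]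
  simp
  ring

lemma sinkhornFinish_ops (K : Plan n) (p q : Fin n → ℝ) (s : Potentials n) :
    (sinkhornFinish K p q s).ops = 11 * n ^ 2 + 10 * n := by
  simp only [sinkhornFinish, bind, scaledKernel_ops, roundPlan_ops]
  ring

lemma sinkhornFinish_val (K : Plan n) (p q : Fin n → ℝ) (s : Potentials n) :
    (sinkhornFinish K p q s).val = (roundPlan p q (scaledKernel K s).val).val := rfl

lemma roundPlan_val (p q : Fin n → ℝ) (B : Plan n) :
    (roundPlan p q B).val =
      let x : Fin n → ℝ := fun i => min (p i / ∑ j, B i j) 1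
      let F₁ : Plan n := fun i j => x i * B i j
      let y : Fin n → ℝ := fun j => min (q j / ∑ i, F₁ i j) 1
      let F₂ : Plan n := fun i j => F₁ i j * y j
      fun i j => F₂ i j + (p i - ∑ j, F₂ i j) * (q j - ∑ i, F₂ i j) /
        ∑ i, |p i - ∑ j, F₂ i j| := rfl

/-! ### Loops -/

section Loop

variable {σ : Type} {body : ℕ → σ → Timed σ} {test : σ → Timed Prop} {S : ℕ → σ}

/-- The body runs before the test, so the exit state is never `S 0`; this is why an index `m + 1`
appears. -/
lemma repeatUntil_sound (hS : ∀ t, (body t (S t)).val = S (t + 1)) {t : ℕ} {s : σ} {t' : ℕ}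
    {s' : σ} {k : ℕ} (h : RepeatUntil body test t s t' s' k) (hs : s = S t) :
    ∃ m, t' = m + 1 ∧ s' = S (m + 1) ∧ (test s').val := by
  induction h with
  | exit t s h => subst hs; exact ⟨t, rfl, hS t, h⟩
  | again t s t' s' k h hk ih => subst hs; exact ih (hS t)

/-- The test need only hold at some later state; the loop may stop sooner. The operation count is
stated additively to avoid the subtraction `t' - t`. -/
lemma repeatUntil_exists (hS : ∀ t, (body t (S t)).val = S (t + 1)) {K : ℕ}
    (hK : ∀ t s, (body t s).ops + (test (body t s).val).ops ≤ K) (m : ℕ) :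
    ∀ t, (test (S (t + m + 1))).val →
      ∃ t' s' k, RepeatUntil body test t (S t) t' s' k ∧ t' ≤ t + m + 1 ∧ k + t * K ≤ t' * K := by
  induction m with
  | zero =>
    intro t h
    refine ⟨_, _, _, RepeatUntil.exit t (S t) (by rw [hS]; exact h), le_rfl, ?_⟩
    have := hK t (S t)
    nlinarith
  | succ m ih =>
    intro t h
    by_cases h0 : (test (S (t + 1))).val
    · refine ⟨_, _, _, RepeatUntil.exit t (S t) (by rw [hS]; exact h0), by omega, ?_⟩
      have := hK t (S t)
      nlinarith
    · obtain ⟨t', s', k, hr, ht, hk⟩ := ih (t + 1) (by convert h using 3; ring)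
      refine ⟨t', s', _, RepeatUntil.again t (S t) t' s' k (by rw [hS]; exact h0)
        (by rw [hS]; exact hr), by omega, ?_⟩
      have := hK t (S t)
      nlinarith

end Loop

end ProxSinkhorn
namespace ProxSinkhorn

/-! ### The transport polytope -/

variable {n : ℕ} {p q : Fin n → ℝ}

lemma le_row_of_mem_polytope {π : Plan n} (h : π ∈ polytope p q) (i j : Fin n) :
    π i j ≤ p i := by
  rw [← h.2.1 i]
  exact Finset.single_le_sum (fun j _ => h.1 i j) (Finset.mem_univ j)

lemma le_col_of_mem_polytope {π : Plan n} (h : π ∈ polytope p q) (i j : Fin n) :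
    π i j ≤ q j := by
  rw [← h.2.2 j]
  exact Finset.single_le_sum (fun i _ => h.1 i j) (Finset.mem_univ i)

lemma sum_sum_of_mem_polytope {π : Plan n} (h : π ∈ polytope p q) :
    ∑ i, ∑ j, π i j = ∑ i, p i := Finset.sum_congr rfl fun i _ => h.2.1 i

lemma le_one_of_mem_stdSimplex (hp : p ∈ stdSimplex ℝ (Fin n)) (i : Fin n) : p i ≤ 1 := by
  rw [← hp.2]
  exact Finset.single_le_sum (fun i _ => hp.1 i) (Finset.mem_univ i)

lemma eq_zero_of_mem_polytope {π : Plan n} (h : π ∈ polytope p q) {i j : Fin n}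
    (hz : p i * q j = 0) : π i j = 0 := by
  rcases mul_eq_zero.1 hz with hz | hz
  · exact le_antisymm (hz ▸ le_row_of_mem_polytope h i j) (h.1 i j)
  · exact le_antisymm (hz ▸ le_col_of_mem_polytope h i j) (h.1 i j)

lemma productPlan_mem_polytope (hp : p ∈ stdSimplex ℝ (Fin n)) (hq : q ∈ stdSimplex ℝ (Fin n)) :
    productPlan p q ∈ polytope p q := by
  refine ⟨fun i j => mul_nonneg (hp.1 i) (hq.1 j), fun i => ?_, fun j => ?_⟩
  · simp [productPlan, ← Finset.mul_sum, hq.2]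
  · simp [productPlan, ← Finset.sum_mul, hp.2]

lemma isCompact_polytope (p q : Fin n → ℝ) : IsCompact (polytope p q) := by
  have hsub : polytope p q ⊆ Set.Icc 0 (fun i _ => p i) := fun π h =>
    ⟨fun i j => h.1 i j, fun i j => le_row_of_mem_polytope h i j⟩
  refine isCompact_Icc.of_isClosed_subset ?_ hsub
  have : polytope p q = (⋂ i, ⋂ j, {π : Plan n | 0 ≤ π i j}) ∩
      ((⋂ i, {π : Plan n | ∑ j, π i j = p i}) ∩ ⋂ j, {π : Plan n | ∑ i, π i j = q j}) := by
    ext π; simp [polytope]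
  rw [this]
  refine IsClosed.inter ?_ (IsClosed.inter ?_ ?_)
  · exact isClosed_iInter fun i => isClosed_iInter fun j =>
      isClosed_le continuous_const (by fun_prop)
  · exact isClosed_iInter fun i => isClosed_eq (by fun_prop) continuous_const
  · exact isClosed_iInter fun i => isClosed_eq (by fun_prop) continuous_const

lemma exists_isLeast_cost (C : Plan n) (hp : p ∈ stdSimplex ℝ (Fin n))
    (hq : q ∈ stdSimplex ℝ (Fin n)) : ∃ m, IsLeast (cost C '' polytope p q) m := by
  have hc : Continuous (cost C) := by unfold cost; fun_prop
  exact ((isCompact_polytope p q).image hc).exists_isLeast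
    (Set.Nonempty.image _ ⟨_, productPlan_mem_polytope hp hq⟩)

lemma averagePlan_apply (π : ℕ → Plan n) (N : ℕ) (i j : Fin n) :
    averagePlan π N i j = (N : ℝ)⁻¹ * ∑ k ∈ Finset.Icc 1 N, π k i j := by
  simp [averagePlan, Finset.sum_apply]

lemma averagePlan_mem_polytope {π : ℕ → Plan n} {N : ℕ} (hN : 0 < N)
    (h : ∀ k ∈ Finset.Icc 1 N, π k ∈ polytope p q) : averagePlan π N ∈ polytope p q := by
  have hN' : (N : ℝ) ≠ 0 := by positivity
  refine ⟨fun i j => ?_, fun i => ?_, fun j => ?_⟩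
  · rw [averagePlan_apply]
    exact mul_nonneg (by positivity) (Finset.sum_nonneg fun k hk => (h k hk).1 i j)
  · simp only [averagePlan_apply]
    rw [← Finset.mul_sum, Finset.sum_comm, Finset.sum_congr rfl fun k hk => (h k hk).2.1 i]
    simp [hN']
  · simp only [averagePlan_apply]
    rw [← Finset.mul_sum, Finset.sum_comm, Finset.sum_congr rfl fun k hk => (h k hk).2.2 j]
    simp [hN']

lemma cost_averagePlan (C : Plan n) (π : ℕ → Plan n) (N : ℕ) :
    cost C (averagePlan π N) = (N : ℝ)⁻¹ * ∑ k ∈ Finset.range N, cost C (π (k + 1)) := by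
  have : ∑ k ∈ Finset.range N, cost C (π (k + 1)) = ∑ k ∈ Finset.Icc 1 N, cost C (π k) := by
    rw [Finset.range_eq_Ico, Finset.sum_Ico_add' (fun k => cost C (π k)) 0 N 1]
    rfl
  rw [this]
  simp only [cost, averagePlan_apply, Finset.mul_sum]
  symm
  rw [Finset.sum_comm]
  refine Finset.sum_congr rfl fun i _ => ?_
  rw [Finset.sum_comm]
  refine Finset.sum_congr rfl fun j _ => Finset.sum_congr rfl fun k _ => by ring

/-- A sub-coupling is completed to a coupling by a rank-one matrix. -/
lemma add_rankOne_mem_polytope {F : Plan n} (hF : ∀ i j, 0 ≤ F i j) (hr : ∀ i, ∑ j, F i j ≤ p i)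
    (hc : ∀ j, ∑ i, F i j ≤ q j) (hpq : ∑ i, p i = ∑ j, q j) :
    (fun i j => F i j + (p i - ∑ j, F i j) * (q j - ∑ i, F i j) / ∑ i, (p i - ∑ j, F i j))
      ∈ polytope p q := by
  set m := ∑ i, (p i - ∑ j, F i j) with hm
  have hm' : m = ∑ j, (q j - ∑ i, F i j) := by
    rw [hm, Finset.sum_sub_distrib, Finset.sum_sub_distrib, hpq, Finset.sum_comm]
  have ha : ∀ i, 0 ≤ p i - ∑ j, F i j := fun i => sub_nonneg.2 (hr i)
  have hb : ∀ j, 0 ≤ q j - ∑ i, F i j := fun j => sub_nonneg.2 (hc j)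
  have hm0 : 0 ≤ m := Finset.sum_nonneg fun i _ => ha i
  refine ⟨fun i j => add_nonneg (hF i j) (div_nonneg (mul_nonneg (ha i) (hb j)) hm0),
    fun i => ?_, fun j => ?_⟩
  · rw [Finset.sum_add_distrib, ← Finset.sum_div, ← Finset.mul_sum, ← hm']
    -- If no mass is missing, every nonnegative defect vanishes, and the quotient by `0` is `0`.
    rcases eq_or_ne m 0 with h0 | h0
    · have := (Finset.sum_eq_zero_iff_of_nonneg fun i _ => ha i).1 h0 i (Finset.mem_univ i)
      rw [h0]; simp; linarith
    · rw [mul_div_cancel_right₀ _ h0]; ring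
  · rw [Finset.sum_add_distrib, ← Finset.sum_div, ← Finset.sum_mul, ← hm]
    rcases eq_or_ne m 0 with h0 | h0
    · have := (Finset.sum_eq_zero_iff_of_nonneg fun j _ => hb j).1 (hm' ▸ h0) j (Finset.mem_univ j)
      rw [h0]; simp; linarith
    · rw [mul_comm, mul_div_cancel_right₀ _ h0]; ring

/-! ### The proximal objective -/

/-- Pointwise form of the nonnegativity of the divergence: summed over two arrays of equal mass, the
left side vanishes. -/
lemma sub_le_mul_log_div {a b : ℝ} (ha : 0 < a) (hb : 0 < b) : b - a ≤ b * Real.log (b / a) := by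
  have h := Real.log_le_sub_one_of_pos (div_pos ha hb)
  have h1 : Real.log (b / a) = - Real.log (a / b) := by
    rw [← Real.log_inv, inv_div]
  rw [h1]
  have h2 : b * Real.log (a / b) ≤ b * (a / b - 1) := mul_le_mul_of_nonneg_left h hb.le
  have h3 : b * (a / b - 1) = a - b := by field_simp
  linarith

lemma proxObjective_eq_sum (C : Plan n) (L : ℝ) (ρ π : Plan n) :
    proxObjective C L ρ π =
      ∑ i, ∑ j, (C i j * π i j + L * (π i j * Real.log (π i j / ρ i j))) := by
  simp only [proxObjective, cost, planKL, Finset.mul_sum, Finset.sum_add_distrib]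

/-- For `r = 0` the conventions `z / 0 = 0` and `log 0 = 0` make the entropic term identically zero,
hence the case split in the derivative. -/
lemma hasDerivAt_entry {C L r x : ℝ} (h : r ≠ 0 → x ≠ 0) :
    HasDerivAt (fun z => C * z + L * (z * Real.log (z / r)))
      (C + L * (if r = 0 then 0 else Real.log (x / r) + 1)) x := by
  by_cases hr : r = 0
  · simpa [hr] using (hasDerivAt_id x).const_mul C
  · have hx := h hr
    have h1 : HasDerivAt (fun z => Real.log (z / r)) (1 / r / (x / r)) x :=
      ((hasDerivAt_id x).div_const r).log (div_ne_zero hx hr)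
    have h2 := ((hasDerivAt_id x).const_mul C).add
      (((hasDerivAt_id x).mul h1).const_mul L)
    refine HasDerivAt.congr_deriv h2 ?_
    simp only [hr, if_false, id]
    field_simp

lemma hasFDerivAt_proxObjective (C : Plan n) (L : ℝ) {ρ x : Plan n}
    (h : ∀ i j, ρ i j ≠ 0 → x i j ≠ 0) :
    HasFDerivAt (proxObjective C L ρ)
      (∑ i, ∑ j, (C i j + L * (if ρ i j = 0 then 0 else Real.log (x i j / ρ i j) + 1)) •
        ((ContinuousLinearMap.proj j : (Fin n → ℝ) →L[ℝ] ℝ).comp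
          (ContinuousLinearMap.proj i : Plan n →L[ℝ] (Fin n → ℝ)))) x := by
  have : proxObjective C L ρ = fun π : Plan n =>
      ∑ i, ∑ j, (C i j * π i j + L * (π i j * Real.log (π i j / ρ i j))) := by
    funext π; exact proxObjective_eq_sum C L ρ π
  rw [this]
  refine HasFDerivAt.fun_sum fun i _ => HasFDerivAt.fun_sum fun j _ => ?_
  exact HasDerivAt.comp_hasFDerivAt x (hasDerivAt_entry (h i j))
    ((ContinuousLinearMap.proj j : (Fin n → ℝ) →L[ℝ] ℝ).comp
          (ContinuousLinearMap.proj i : Plan n →L[ℝ] (Fin n → ℝ))).hasFDerivAt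

lemma fderiv_proxObjective (C : Plan n) (L : ℝ) {ρ x : Plan n}
    (h : ∀ i j, ρ i j ≠ 0 → x i j ≠ 0) (v : Plan n) :
    fderiv ℝ (proxObjective C L ρ) x v =
      ∑ i, ∑ j, (C i j + L * (if ρ i j = 0 then 0 else Real.log (x i j / ρ i j) + 1)) * v i j := by
  rw [(hasFDerivAt_proxObjective C L h).fderiv]
  simp

/-- Along the coordinate direction `(i, j)` the objective at a vanishing entry is an affine function
plus `L s ln s`, which is not differentiable at `0`. Differentiability in the definition of
precision therefore keeps the support of the iterates. -/
lemma ne_zero_of_differentiableAt_proxObjective {C : Plan n} {L : ℝ} (hL : L ≠ 0) {ρ x : Plan n}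
    (h : DifferentiableAt ℝ (proxObjective C L ρ) x) {i j : Fin n} (hρ : ρ i j ≠ 0) :
    x i j ≠ 0 := by
  intro hx
  set e : Plan n := Pi.single i (Pi.single j 1) with he
  have heq : ∀ s : ℝ, proxObjective C L ρ (x + s • e) =
      proxObjective C L ρ x + (C i j * s + L * (s * Real.log (s / ρ i j))) := by
    intro s
    rw [← sub_eq_iff_eq_add', proxObjective_eq_sum, proxObjective_eq_sum,
      ← Finset.sum_sub_distrib, Finset.sum_eq_single i, ← Finset.sum_sub_distrib,
      Finset.sum_eq_single j]
    · simp [he, hx]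
    · intro j' _ hj'
      simp [he, hj']
    · simp
    · intro i' _ hi'
      simp [he, hi']
    · simp
  have hline : DifferentiableAt ℝ (fun s : ℝ => proxObjective C L ρ (x + s • e)) 0 := by
    refine DifferentiableAt.comp (0 : ℝ) (g := proxObjective C L ρ) (by simpa using h) ?_
    fun_prop
  have h2 : DifferentiableAt ℝ (fun s : ℝ => s * Real.log s) 0 := by
    have h3 : (fun s : ℝ => s * Real.log s) = fun s => L⁻¹ *
        (proxObjective C L ρ (x + s • e) - proxObjective C L ρ x - C i j * s) +
          s * Real.log (ρ i j) := by
      funext s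
      rw [heq]
      rcases eq_or_ne s 0 with rfl | hs
      · simp
      · rw [Real.log_div hs hρ]; field_simp; ring
    rw [h3]
    fun_prop
  exact Real.not_DifferentiableAt_log_mul_zero (by simpa [mul_comm] using h2)

/-! ### The outer iterations -/

/-- Gibbs' inequality against the uniform distribution. -/
lemma entropy_le_log_card (hn : 0 < n) (hp : p ∈ stdSimplex ℝ (Fin n)) :
    -∑ i, p i * Real.log (p i) ≤ Real.log n := by
  have hn' : (0 : ℝ) < n := by exact_mod_cast hn
  have h : ∀ i, -(p i * Real.log (p i)) ≤ p i * Real.log n + ((n : ℝ)⁻¹ - p i) := by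
    intro i
    rcases (hp.1 i).eq_or_lt with h0 | h0
    · rw [← h0]; simp
    · have h1 := sub_le_mul_log_div (a := (n : ℝ)⁻¹) (by positivity) h0
      rw [div_inv_eq_mul, Real.log_mul h0.ne' hn'.ne'] at h1
      linarith
  have h2 := Finset.sum_le_sum fun i (_ : i ∈ Finset.univ) => h i
  rw [Finset.sum_add_distrib, Finset.sum_sub_distrib, ← Finset.sum_mul, hp.2] at h2
  simp only [Finset.sum_neg_distrib, Finset.sum_const, Finset.card_univ, Fintype.card_fin,
    nsmul_eq_mul] at h2
  rw [mul_inv_cancel₀ hn'.ne'] at h2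
  linarith

lemma neg_sum_mul_log_productPlan_le (hn : 0 < n) (hp : p ∈ stdSimplex ℝ (Fin n))
    (hq : q ∈ stdSimplex ℝ (Fin n)) {y : Plan n} (hy : y ∈ polytope p q) :
    -∑ i, ∑ j, y i j * Real.log (productPlan p q i j) ≤ 2 * Real.log n := by
  have h : ∀ i j, y i j * Real.log (productPlan p q i j) =
      y i j * Real.log (p i) + y i j * Real.log (q j) := by
    intro i j
    by_cases h0 : p i * q j = 0
    · simp [eq_zero_of_mem_polytope hy h0]
    · rw [productPlan, Real.log_mul (left_ne_zero_of_mul h0) (right_ne_zero_of_mul h0)]; ring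
  have h1 : ∑ i, ∑ j, y i j * Real.log (productPlan p q i j) =
      ∑ i, p i * Real.log (p i) + ∑ j, q j * Real.log (q j) := by
    simp only [h, Finset.sum_add_distrib]
    congr 1
    · exact Finset.sum_congr rfl fun i _ => by rw [← Finset.sum_mul, hy.2.1]
    · rw [Finset.sum_comm]
      exact Finset.sum_congr rfl fun i _ => by rw [← Finset.sum_mul, hy.2.2]
  have := entropy_le_log_card hn hp
  have := entropy_le_log_card hn hq
  linarith

/-- One step of the telescoping estimate. The terms in `ln y` of the usual three-point identity
cancel, so they are omitted and `y` may have zero entries. -/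
lemma cost_sub_le_of_isInexactMin {C : Plan n} {L δ : ℝ} (hL : 0 < L) {Q : Set (Plan n)}
    (hQ : Q ⊆ polytope p q) {a b y : Plan n} (ha : a ∈ polytope p q)
    (hsupp : ∀ i j, p i * q j ≠ 0 → a i j ≠ 0)
    (hb : IsInexactMin Q (proxObjective C L a) δ b) (hy : y ∈ Q) :
    cost C b - cost C y ≤
      δ + L * (∑ i, ∑ j, y i j * Real.log (b i j) - ∑ i, ∑ j, y i j * Real.log (a i j)) := by
  have hne : ∀ i j, a i j ≠ 0 → b i j ≠ 0 := fun i j h =>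
    ne_zero_of_differentiableAt_proxObjective hL.ne' hb.2.1 h
  have hbp := hQ hb.1
  have hyp := hQ hy
  have h := hb.2.2 y hy
  rw [fderiv_proxObjective C L hne] at h
  -- The differences `b - y` and `b - a` sum to zero, the three plans having the same marginals; `b
  -- - a` is the lower bound for `b ln (b/a)`.
  have hterm : ∀ i j, C i j * b i j - C i j * y i j + L * ((b i j - y i j) +
      (y i j * Real.log (a i j) - y i j * Real.log (b i j)) + (b i j - a i j)) ≤
      (C i j + L * (if a i j = 0 then 0 else Real.log (b i j / a i j) + 1)) * (b - y) i j := by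
    intro i j
    by_cases h0 : a i j = 0
    · have hz : p i * q j = 0 := by by_contra hz; exact hsupp i j hz h0
      simp [eq_zero_of_mem_polytope hbp hz, eq_zero_of_mem_polytope hyp hz, h0]
    · have ha0 : 0 < a i j := lt_of_le_of_ne (ha.1 i j) (Ne.symm h0)
      have hb0 : 0 < b i j := lt_of_le_of_ne (hbp.1 i j) (Ne.symm (hne i j h0))
      have h1 := mul_le_mul_of_nonneg_left (sub_le_mul_log_div ha0 hb0) hL.le
      simp only [h0, if_false, Pi.sub_apply]
      rw [Real.log_div hb0.ne' h0] at h1 ⊢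
      nlinarith
  have hsum := Finset.sum_le_sum fun i (_ : i ∈ Finset.univ) =>
    Finset.sum_le_sum fun j (_ : j ∈ Finset.univ) => hterm i j
  simp only [Finset.sum_add_distrib, Finset.sum_sub_distrib, ← Finset.mul_sum] at hsum
  simp only [hbp.2.1, hyp.2.1, ha.2.1] at hsum
  simp only [cost]
  linarith

/-- Keeping `Q` general serves both the whole polytope and the truncated one. -/
lemma cost_averagePlan_le (hn : 0 < n) (hp : p ∈ stdSimplex ℝ (Fin n))
    (hq : q ∈ stdSimplex ℝ (Fin n)) {C : Plan n} {L δ : ℝ} (hL : 0 < L) {Q : Set (Plan n)}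
    (hQ : Q ⊆ polytope p q) {N : ℕ} (hN : 0 < N) {π : ℕ → Plan n} (h0 : π 0 = productPlan p q)
    (h : ∀ k < N, IsInexactMin Q (proxObjective C L (π k)) δ (π (k + 1)))
    {y : Plan n} (hy : y ∈ Q) :
    cost C (averagePlan π N) ≤ cost C y + δ + 2 * L * Real.log n / N := by
  have hN' : (0 : ℝ) < N := by exact_mod_cast hN
  have hmem : ∀ k ≤ N, π k ∈ polytope p q ∧ ∀ i j, p i * q j ≠ 0 → π k i j ≠ 0 := by
    intro k
    induction k with
    | zero => exact fun _ => h0 ▸ ⟨productPlan_mem_polytope hp hq, fun i j hij => hij⟩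
    | succ k ih => exact fun hk => ⟨hQ (h k hk).1, fun i j hij =>
        ne_zero_of_differentiableAt_proxObjective hL.ne' (h k hk).2.1 ((ih (by omega)).2 i j hij)⟩
  have hstep := Finset.sum_le_sum fun k (hk : k ∈ Finset.range N) =>
    have hk := Finset.mem_range.1 hk
    cost_sub_le_of_isInexactMin hL hQ (hmem k hk.le).1 (hmem k hk.le).2 (h k hk) hy
  rw [Finset.sum_add_distrib, ← Finset.mul_sum, Finset.sum_range_sub
    (fun k => ∑ i, ∑ j, y i j * Real.log (π k i j)), Finset.sum_sub_distrib, h0] at hstep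
  simp only [Finset.sum_const, Finset.card_range, nsmul_eq_mul] at hstep
  have h1 := neg_sum_mul_log_productPlan_le hn hp hq (hQ hy)
  have h2 : ∑ i, ∑ j, y i j * Real.log (π N i j) ≤ 0 :=
    Finset.sum_nonpos fun i _ => Finset.sum_nonpos fun j _ =>
      mul_nonpos_of_nonneg_of_nonpos ((hQ hy).1 i j)
        (Real.log_nonpos ((hmem N le_rfl).1.1 i j)
          ((le_row_of_mem_polytope (hmem N le_rfl).1 i j).trans (le_one_of_mem_stdSimplex hp i)))
  have h3 : ∑ k ∈ Finset.range N, cost C (π (k + 1)) ≤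
      N * (cost C y + δ) + L * (2 * Real.log n) := by
    have := mul_le_mul_of_nonneg_left (a := L) (by linarith :
      ∑ i, ∑ j, y i j * Real.log (π N i j) -
        ∑ i, ∑ j, y i j * Real.log (productPlan p q i j) ≤ 2 * Real.log n) hL.le
    linarith
  rw [cost_averagePlan, inv_mul_le_iff₀ hN']
  refine h3.trans (le_of_eq ?_)
  field_simp

lemma pos_of_four_mul_log_le (hn : 2 ≤ n) {L ε : ℝ} (hL : 0 < L) (hε : 0 < ε) {N : ℕ}
    (hN : 4 * L * Real.log n / ε ≤ N) : 0 < N := by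
  have h1 : 0 < Real.log n := Real.log_pos (by exact_mod_cast hn)
  have : (0 : ℝ) < N := lt_of_lt_of_le (by positivity) hN
  exact_mod_cast this

lemma two_mul_log_div_le (hn : 2 ≤ n) {L ε : ℝ} (hL : 0 < L) (hε : 0 < ε) {N : ℕ}
    (hN : 4 * L * Real.log n / ε ≤ N) : 2 * L * Real.log n / N ≤ ε / 2 := by
  have hN0 : (0 : ℝ) < N := by exact_mod_cast pos_of_four_mul_log_le hn hL hε hN
  rw [div_le_iff₀ hε] at hN
  rw [div_le_iff₀ hN0]
  linarith

lemma isEpsOptimal_averagePlan (hn : 2 ≤ n) {C : Plan n} (hp : p ∈ stdSimplex ℝ (Fin n))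
    (hq : q ∈ stdSimplex ℝ (Fin n)) {L ε : ℝ} (hL : 0 < L) (hε : 0 < ε) {N : ℕ}
    (hN : 4 * L * Real.log n / ε ≤ N) {π : ℕ → Plan n}
    (h : IsProxIterates C p q L (ε / 2) N π) : IsEpsOptimal C p q ε (averagePlan π N) := by
  have hN0 := pos_of_four_mul_log_le hn hL hε hN
  obtain ⟨m, hm⟩ := exists_isLeast_cost C hp hq
  refine ⟨averagePlan_mem_polytope hN0 fun k hk => ?_, m, hm, ?_⟩
  · obtain ⟨h1, h2⟩ := Finset.mem_Icc.1 hk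
    obtain ⟨k, rfl⟩ := Nat.exists_eq_add_of_le' h1
    exact (h.2 k (by omega)).1
  · obtain ⟨y, hy, rfl⟩ := hm.1
    have h1 := cost_averagePlan_le (by omega) hp hq hL subset_rfl hN0 h.1 h.2 hy
    have h2 := two_mul_log_div_le hn hL hε hN
    linarith

end ProxSinkhorn
namespace ProxSinkhorn

/-! ### Proximal steps over truncated polytopes -/

variable {n : ℕ} {p q : Fin n → ℝ}

lemma truncatedPolytope_subset (s : ℝ) : truncatedPolytope p q s ⊆ polytope p q := fun _ h => h.1

lemma segment_mem_truncatedPolytope {s : ℝ} {x y : Plan n} (hs : 0 ≤ s)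
    (hx : x ∈ truncatedPolytope p q s) (hy : y ∈ truncatedPolytope p q s) {τ : ℝ} (h0 : 0 ≤ τ)
    (h1 : τ ≤ 1) : (fun i j => x i j + τ * (y i j - x i j)) ∈ truncatedPolytope p q s := by
  have hlow : ∀ i j, s ≤ x i j + τ * (y i j - x i j) := by
    intro i j
    have := hx.2 i j
    have := hy.2 i j
    nlinarith
  refine ⟨⟨fun i j => hs.trans (hlow i j), fun i => ?_, fun j => ?_⟩, hlow⟩
  · rw [Finset.sum_add_distrib, ← Finset.mul_sum, Finset.sum_sub_distrib, hx.1.2.1, hy.1.2.1]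
    ring
  · rw [Finset.sum_add_distrib, ← Finset.mul_sum, Finset.sum_sub_distrib, hx.1.2.2, hy.1.2.2]
    ring

/-- Entries lie in `[0, 1]`, so each square is at most `x + y`, and both plans have mass one. -/
lemma sum_sq_sub_le_two (hp : p ∈ stdSimplex ℝ (Fin n)) {x y : Plan n} (hx : x ∈ polytope p q)
    (hy : y ∈ polytope p q) : ∑ i, ∑ j, (y i j - x i j) ^ 2 ≤ 2 := by
  have h : ∀ i j, (y i j - x i j) ^ 2 ≤ x i j + y i j := by
    intro i j
    have hx0 := hx.1 i j
    have hy0 := hy.1 i j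
    have hx1 := (le_row_of_mem_polytope hx i j).trans (le_one_of_mem_stdSimplex hp i)
    have hy1 := (le_row_of_mem_polytope hy i j).trans (le_one_of_mem_stdSimplex hp i)
    nlinarith [mul_nonneg hx0 hy0]
  calc ∑ i, ∑ j, (y i j - x i j) ^ 2 ≤ ∑ i, ∑ j, (x i j + y i j) :=
        Finset.sum_le_sum fun i _ => Finset.sum_le_sum fun j _ => h i j
    _ = 2 := by
        simp only [Finset.sum_add_distrib, hx.2.1, hy.2.1, hp.2]
        norm_num

/-- The Bregman remainder of `z ln z` at `x` is at most the chi-square term `(z - x)² / x`. -/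
lemma mul_log_div_sub_le {x z s : ℝ} (hs : 0 < s) (hx : s ≤ x) (hz : 0 < z) :
    z * Real.log (z / x) - (z - x) ≤ (z - x) ^ 2 / s := by
  have hx0 : 0 < x := hs.trans_le hx
  have h1 := mul_le_mul_of_nonneg_left (Real.log_le_sub_one_of_pos (div_pos hz hx0)) hz.le
  have h2 : z * (z / x - 1) - (z - x) = (z - x) ^ 2 / x := by field_simp
  have h3 : (z - x) ^ 2 / x ≤ (z - x) ^ 2 / s := by gcongr
  linarith

/-- An objective residual bounds the precision, up to a trade-off in the step size `τ`. -/
lemma fderiv_proxObjective_le_of_isResidualMin (hp : p ∈ stdSimplex ℝ (Fin n)) {C : Plan n}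
    {L δ s : ℝ} (hL : 0 < L) (hs : 0 < s) {ρ x y : Plan n} (hρ : ∀ i j, 0 < ρ i j)
    (hx : IsResidualMin (truncatedPolytope p q s) (proxObjective C L ρ) δ x)
    (hy : y ∈ truncatedPolytope p q s) {τ : ℝ} (h0 : 0 < τ) (h1 : τ ≤ 1) :
    fderiv ℝ (proxObjective C L ρ) x (x - y) ≤ δ / τ + 2 * L * τ / s := by
  have hx0 : ∀ i j, 0 < x i j := fun i j => hs.trans_le (hx.1.2 i j)
  rw [fderiv_proxObjective C L fun i j _ => (hx0 i j).ne']
  set z : Plan n := fun i j => x i j + τ * (y i j - x i j) with hz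
  have hzmem := segment_mem_truncatedPolytope hs.le hx.1 hy h0.le h1
  have hz0 : ∀ i j, 0 < z i j := fun i j => hs.trans_le (hzmem.2 i j)
  have hres := hx.2 z hzmem
  -- Expansion of the objective at `x` along the segment to `y`; the last summand bounds the
  -- second-order remainder.
  have hterm : ∀ i j,
      (C i j * z i j + L * (z i j * Real.log (z i j / ρ i j))) +
        τ * ((C i j + L * (if ρ i j = 0 then 0 else Real.log (x i j / ρ i j) + 1)) *
          (x - y) i j) ≤
      (C i j * x i j + L * (x i j * Real.log (x i j / ρ i j))) +
        L * (τ ^ 2 / s) * (y i j - x i j) ^ 2 := by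
    intro i j
    have h2 := mul_le_mul_of_nonneg_left (mul_log_div_sub_le hs (hx.1.2 i j) (hz0 i j)) hL.le
    simp only [(hρ i j).ne', if_false, Pi.sub_apply]
    rw [Real.log_div (hz0 i j).ne' (hx0 i j).ne'] at h2
    rw [Real.log_div (hz0 i j).ne' (hρ i j).ne', Real.log_div (hx0 i j).ne' (hρ i j).ne']
    have h3 : z i j - x i j = τ * (y i j - x i j) := by simp [hz]
    have h4 : L * ((z i j - x i j) ^ 2 / s) = L * (τ ^ 2 / s) * (y i j - x i j) ^ 2 := by
      rw [h3]; ring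
    rw [h4] at h2
    have h5 : τ * (x i j - y i j) = -(z i j - x i j) := by rw [h3]; ring
    have h6 : τ * ((C i j + L * (Real.log (x i j) - Real.log (ρ i j) + 1)) * (x i j - y i j)) =
      (C i j + L * (Real.log (x i j) - Real.log (ρ i j) + 1)) * (-(z i j - x i j)) := by
      rw [← h5]; ring
    rw [h6]
    linarith
  have hsum := Finset.sum_le_sum fun i (_ : i ∈ Finset.univ) =>
    Finset.sum_le_sum fun j (_ : j ∈ Finset.univ) => hterm i j
  simp only [Finset.sum_add_distrib, ← Finset.mul_sum] at hsum
  simp only [proxObjective, cost, planKL] at hres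
  have hsq := mul_le_mul_of_nonneg_left (sum_sq_sub_le_two hp hx.1.1 hy.1)
    (by positivity : 0 ≤ L * (τ ^ 2 / s))
  have hfin : τ * ∑ i, ∑ j, (C i j + L * (if ρ i j = 0 then 0 else Real.log (x i j / ρ i j) + 1)) *
      (x - y) i j ≤ δ + L * (τ ^ 2 / s) * 2 := by linarith
  have : δ / τ + 2 * L * τ / s = (δ + L * (τ ^ 2 / s) * 2) / τ := by field_simp
  rw [this, le_div_iff₀ h0]
  linarith

lemma cost_le_norm_mul (C : Plan n) {E : Plan n} (hE : ∀ i j, 0 ≤ E i j) :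
    cost C E ≤ ‖C‖ * ∑ i, ∑ j, E i j := by
  simp only [cost, Finset.mul_sum]
  refine Finset.sum_le_sum fun i _ => Finset.sum_le_sum fun j _ =>
    mul_le_mul_of_nonneg_right ?_ (hE i j)
  exact (le_abs_self _).trans ((norm_le_pi_norm (C i) j).trans (norm_le_pi_norm C i))

/-- Every plan is close to a plan with large entries, if there are any of those. -/
lemma exists_mem_truncatedPolytope_cost_le (hp : p ∈ stdSimplex ℝ (Fin n))
    (hq : q ∈ stdSimplex ℝ (Fin n)) {C : Plan n} (hC : ∀ i j, 0 ≤ C i j) (hn : 0 < n) {s : ℝ}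
    (hs : 0 < s) (hne : (truncatedPolytope p q s).Nonempty) {y : Plan n} (hy : y ∈ polytope p q) :
    ∃ z ∈ truncatedPolytope p q s, cost C z ≤ cost C y + ‖C‖ * (2 * s * n ^ 2) := by
  obtain ⟨w, hw⟩ := hne
  have hn' : (0 : ℝ) < n := by exact_mod_cast hn
  have hps : ∀ i, n * s ≤ p i := fun i => by
    rw [← hw.1.2.1 i]
    simpa using Finset.card_nsmul_le_sum Finset.univ (w i) s fun j _ => hw.2 i j
  have hqs : ∀ j, n * s ≤ q j := fun j => by
    rw [← hw.1.2.2 j]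
    simpa using Finset.card_nsmul_le_sum Finset.univ (fun i => w i j) s fun i _ => hw.2 i j
  have hns : 0 < n * s := by positivity
  have hp0 : ∀ i, 0 < p i := fun i => hns.trans_le (hps i)
  have hq0 : ∀ j, 0 < q j := fun j => hns.trans_le (hqs j)
  -- These fractions free mass `n s` in every row and column: `F` fits under the marginals `p - n s`
  -- and `q - n s`, is completed to them by a rank-one matrix, and `s` is then added to every entry.
  set a : Fin n → ℝ := fun i => n * s / p i with ha
  set b : Fin n → ℝ := fun j => n * s / q j with hb
  have ha0 : ∀ i, 0 ≤ a i := fun i => by have := hp0 i; positivity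
  have hb0 : ∀ j, 0 ≤ b j := fun j => by have := hq0 j; positivity
  have ha1 : ∀ i, a i ≤ 1 := fun i => (div_le_one (hp0 i)).2 (hps i)
  have hb1 : ∀ j, b j ≤ 1 := fun j => (div_le_one (hq0 j)).2 (hqs j)
  set F : Plan n := fun i j => (1 - a i) * (1 - b j) * y i j with hF
  have hF0 : ∀ i j, 0 ≤ F i j := fun i j =>
    mul_nonneg (mul_nonneg (sub_nonneg.2 (ha1 i)) (sub_nonneg.2 (hb1 j))) (hy.1 i j)
  have hFy : ∀ i j, F i j ≤ y i j := fun i j => by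
    have : (1 - a i) * (1 - b j) ≤ 1 := by
      nlinarith [ha0 i, hb0 j, ha1 i, hb1 j]
    nlinarith [hy.1 i j]
  have hrow : ∀ i, ∑ j, F i j ≤ p i - n * s := fun i => by
    calc ∑ j, F i j ≤ ∑ j, (1 - a i) * y i j := Finset.sum_le_sum fun j _ => by
          have := mul_nonneg (mul_nonneg (sub_nonneg.2 (ha1 i)) (hb0 j)) (hy.1 i j)
          simp only [hF]; nlinarith
      _ = p i - n * s := by
          rw [← Finset.mul_sum, hy.2.1]; simp only [ha]
          have := hp0 i
          field_simp
  have hcol : ∀ j, ∑ i, F i j ≤ q j - n * s := fun j => by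
    calc ∑ i, F i j ≤ ∑ i, (1 - b j) * y i j := Finset.sum_le_sum fun i _ => by
          have := mul_nonneg (mul_nonneg (sub_nonneg.2 (hb1 j)) (ha0 i)) (hy.1 i j)
          simp only [hF]; nlinarith
      _ = q j - n * s := by
          rw [← Finset.mul_sum, hy.2.2]; simp only [hb]
          have := hq0 j
          field_simp
  have hmass : ∑ i, (p i - n * s) = ∑ j, (q j - n * s) := by
    rw [Finset.sum_sub_distrib, Finset.sum_sub_distrib, hp.2, hq.2]
  have hG := add_rankOne_mem_polytope hF0 hrow hcol hmass
  set G : Plan n := fun i j => F i j + (p i - n * s - ∑ j, F i j) * (q j - n * s - ∑ i, F i j) /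
    ∑ i, (p i - n * s - ∑ j, F i j) with hGdef
  have hFG : ∀ i j, 0 ≤ G i j - F i j := fun i j => by
    simp only [hGdef, add_sub_cancel_left]
    exact div_nonneg (mul_nonneg (sub_nonneg.2 (hrow i)) (sub_nonneg.2 (hcol j)))
      (Finset.sum_nonneg fun i _ => sub_nonneg.2 (hrow i))
  have hz : (fun i j => G i j + s) ∈ truncatedPolytope p q s := by
    have hlow : ∀ i j, s ≤ G i j + s := fun i j => by linarith [hG.1 i j]
    refine ⟨⟨fun i j => hs.le.trans (hlow i j), fun i => ?_, fun j => ?_⟩, hlow⟩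
    · rw [Finset.sum_add_distrib, hG.2.1]; simp
    · rw [Finset.sum_add_distrib, hG.2.2]; simp
  refine ⟨_, hz, ?_⟩
  have hE : ∀ i j, 0 ≤ G i j - F i j + s := fun i j => add_nonneg (hFG i j) hs.le
  have h1 := cost_le_norm_mul C hE
  have h2 : cost C F ≤ cost C y := Finset.sum_le_sum fun i _ => Finset.sum_le_sum fun j _ =>
    mul_le_mul_of_nonneg_left (hFy i j) (hC i j)
  have h3 : cost C (fun i j => G i j + s) = cost C F + cost C fun i j => G i j - F i j + s := by
    simp only [cost, ← Finset.sum_add_distrib]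
    exact Finset.sum_congr rfl fun i _ => Finset.sum_congr rfl fun j _ => by ring
  -- The added mass equals the mass removed from `y`, at most `n² s` for rows and `n² s` for
  -- columns.
  have h4 : ∑ i, ∑ j, (G i j - F i j + s) ≤ 2 * s * n ^ 2 := by
    have hay : ∑ i, ∑ j, a i * y i j = n * (n * s) := by
      simp only [← Finset.mul_sum, hy.2.1, ha]
      rw [Finset.sum_congr rfl fun i _ => div_mul_cancel₀ _ (hp0 i).ne']
      simp
    have hby : ∑ i, ∑ j, b j * y i j = n * (n * s) := by
      rw [Finset.sum_comm]
      simp only [← Finset.mul_sum, hy.2.2, hb]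
      rw [Finset.sum_congr rfl fun i _ => div_mul_cancel₀ _ (hq0 i).ne']
      simp
    have hlow : ∑ i, ∑ j, (y i j - a i * y i j - b j * y i j) ≤ ∑ i, ∑ j, F i j :=
      Finset.sum_le_sum fun i _ => Finset.sum_le_sum fun j _ => by
        have := mul_nonneg (mul_nonneg (ha0 i) (hb0 j)) (hy.1 i j)
        simp only [hF]; nlinarith
    simp only [Finset.sum_sub_distrib, hay, hby, sum_sum_of_mem_polytope hy, hp.2] at hlow
    have hGsum := sum_sum_of_mem_polytope hG
    simp only [Finset.sum_sub_distrib, hp.2] at hGsum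
    simp only [Finset.sum_add_distrib, Finset.sum_sub_distrib, hGsum]
    simp only [Finset.sum_const, Finset.card_univ, Fintype.card_fin, nsmul_eq_mul] at *
    nlinarith
  have h5 := mul_le_mul_of_nonneg_left h4 (norm_nonneg C)
  rw [h3]
  linarith

lemma truncated_prox_steps (hn : 2 ≤ n) (hp : p ∈ stdSimplex ℝ (Fin n))
    (hq : q ∈ stdSimplex ℝ (Fin n)) {C : Plan n} (hC : ∀ i j, 0 ≤ C i j) {L ε εt : ℝ}
    (hL : 0 < L) (hε : 0 < ε) (hεL : ε ≤ 4 * L * Real.log n)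
    (hεt : εt ≤ 1 / 1000 * (ε ^ 4 / (L * (n : ℝ) ^ 4))) {N : ℕ}
    (hN : 4 * L * Real.log n / ε ≤ N) {π : ℕ → Plan n} (h0 : π 0 = productPlan p q)
    (h : ∀ m < N, IsResidualMin (truncatedPolytope p q (ε / (4 * (n : ℝ) ^ 2)))
      (proxObjective C L (π m)) εt (π (m + 1))) :
    (∀ m < N, IsInexactMin (truncatedPolytope p q (ε / (4 * (n : ℝ) ^ 2)))
      (proxObjective C L (π m)) (ε / 2) (π (m + 1))) ∧
    IsEpsOptimal C p q ((1 + ‖C‖) * ε) (averagePlan π N) := by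
  have hN0 := pos_of_four_mul_log_le hn hL hε hN
  have hn2 : (2 : ℝ) ≤ n := by exact_mod_cast hn
  have hn0 : (0 : ℝ) < n := by linarith
  have hlog : Real.log n ≤ n := (Real.log_le_sub_one_of_pos hn0).trans (by linarith)
  set s := ε / (4 * (n : ℝ) ^ 2) with hs_def
  have hs : 0 < s := by positivity
  have hsn : s * (4 * (n : ℝ) ^ 2) = ε := by rw [hs_def]; field_simp
  have hQ1 := (h 0 hN0).1
  have hps : ∀ i, 0 < p i := fun i =>
    (hs.trans_le (hQ1.2 i i)).trans_le (le_row_of_mem_polytope hQ1.1 i i)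
  have hqs : ∀ j, 0 < q j := fun j =>
    (hs.trans_le (hQ1.2 j j)).trans_le (le_col_of_mem_polytope hQ1.1 j j)
  -- The truncated polytope is nonempty, so its `n²` lower bounds `s` add up to at most one.
  have hε4 : ε ≤ 4 := by
    have h1 : (n : ℝ) * (n * s) ≤ 1 := by
      rw [← hp.2, ← sum_sum_of_mem_polytope hQ1.1]
      have : ∑ _i : Fin n, ∑ _j : Fin n, s ≤ ∑ i, ∑ j, π (0 + 1) i j :=
        Finset.sum_le_sum fun i _ => Finset.sum_le_sum fun j _ => hQ1.2 i j
      simpa using this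
    nlinarith
  have hpos : ∀ m ≤ N, ∀ i j, 0 < π m i j := by
    intro m hm i j
    rcases m with _ | m
    · rw [h0]; exact mul_pos (hps i) (hqs j)
    · exact hs.trans_le ((h m (by omega)).1.2 i j)
  have hinex : ∀ m < N, IsInexactMin (truncatedPolytope p q s)
      (proxObjective C L (π m)) (ε / 2) (π (m + 1)) := by
    intro m hm
    refine ⟨(h m hm).1, (hasFDerivAt_proxObjective C L fun i j _ =>
      (hpos (m + 1) (by omega) i j).ne').differentiableAt, fun y hy => ?_⟩
    have hε2 : ε ^ 2 ≤ 32 * L * n ^ 2 := by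
      have h1 : ε * ε ≤ 4 * (4 * L * Real.log n) := mul_le_mul hε4 hεL hε.le (by norm_num)
      have h2 : L * Real.log n ≤ L * n ^ 2 := by
        refine mul_le_mul_of_nonneg_left ?_ hL.le
        nlinarith
      nlinarith
    -- This `τ` makes the curvature term `2 L τ / s` exactly `ε / 4`; the bound on `εt` leaves `ε /
    -- 4` for the residual term `εt / τ`.
    have h1 := fderiv_proxObjective_le_of_isResidualMin hp hL hs (hpos m hm.le) (h m hm) hy
      (τ := ε ^ 2 / (32 * L * n ^ 2)) (by positivity) (div_le_one_of_le₀ hε2 (by positivity))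
    have h2 : 2 * L * (ε ^ 2 / (32 * L * n ^ 2)) / s = ε / 4 := by
      rw [hs_def]; field_simp; norm_num
    have h3 : εt / (ε ^ 2 / (32 * L * n ^ 2)) ≤ ε / 4 := by
      rw [div_le_iff₀ (by positivity)]
      refine hεt.trans ?_
      have h4 : ε / 4 * (ε ^ 2 / (32 * L * n ^ 2)) = (128 : ℝ)⁻¹ * (ε ^ 3 / (L * n ^ 2)) := by
        field_simp
        norm_num
      have h5 : 1 / 1000 * (ε ^ 4 / (L * (n : ℝ) ^ 4)) =
          (ε / n ^ 2 / 1000) * (ε ^ 3 / (L * n ^ 2)) := by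
        field_simp
      rw [h4, h5]
      refine mul_le_mul_of_nonneg_right ?_ (by positivity)
      rw [div_div, div_le_iff₀ (by positivity)]
      nlinarith
    linarith
  refine ⟨hinex, averagePlan_mem_polytope hN0 fun k hk => ?_, ?_⟩
  · obtain ⟨h1, h2⟩ := Finset.mem_Icc.1 hk
    obtain ⟨k, rfl⟩ := Nat.exists_eq_add_of_le' h1
    exact (h k (by omega)).1.1
  · obtain ⟨m, hm⟩ := exists_isLeast_cost C hp hq
    refine ⟨m, hm, ?_⟩
    obtain ⟨y, hy, rfl⟩ := hm.1
    obtain ⟨z, hz, hzy⟩ := exists_mem_truncatedPolytope_cost_le hp hq hC (by omega) hs ⟨_, hQ1⟩ hy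
    have h1 := cost_averagePlan_le (by omega) hp hq hL (truncatedPolytope_subset s) hN0 h0 hinex hz
    have h2 := two_mul_log_div_le hn hL hε hN
    have h3 : ‖C‖ * (2 * s * n ^ 2) ≤ ‖C‖ * ε :=
      mul_le_mul_of_nonneg_left (by nlinarith) (norm_nonneg C)
    linarith

end ProxSinkhorn
namespace ProxSinkhorn

/-! ### Soft-min transforms and their contraction property -/

variable {n : ℕ}

/-- The potential that normalizes the rows of `w j * exp (x i + f j - m i j)`. -/
noncomputable def softPot (w : Fin n → ℝ) (m : Plan n) (f : Fin n → ℝ) : Fin n → ℝ :=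
  fun i => -Real.log (∑ j, w j * Real.exp (f j - m i j))

lemma sum_mul_exp_pos (hn : 0 < n) {w : Fin n → ℝ} (hw : ∀ j, 0 < w j) (f : Fin n → ℝ) :
    0 < ∑ j, w j * Real.exp (f j) :=
  Finset.sum_pos (fun j _ => mul_pos (hw j) (Real.exp_pos _)) ⟨⟨0, hn⟩, Finset.mem_univ _⟩

lemma exp_neg_softPot (hn : 0 < n) {w : Fin n → ℝ} (hw : ∀ j, 0 < w j) (m : Plan n)
    (f : Fin n → ℝ) (i : Fin n) :
    Real.exp (-softPot w m f i) = ∑ j, w j * Real.exp (f j - m i j) := by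
  rw [softPot, neg_neg, Real.exp_log (sum_mul_exp_pos hn hw _)]

lemma softPot_sub_le (hn : 0 < n) {w : Fin n → ℝ} (hw : ∀ j, 0 < w j) {m : Plan n} {R : ℝ}
    (hm : ∀ i j i' j', m i j - m i' j' ≤ R) (f : Fin n → ℝ) (i i' : Fin n) :
    softPot w m f i - softPot w m f i' ≤ R := by
  have h : Real.exp (-softPot w m f i') ≤ Real.exp (R + -softPot w m f i) := by
    rw [Real.exp_add, exp_neg_softPot hn hw, exp_neg_softPot hn hw, Finset.mul_sum]
    refine Finset.sum_le_sum fun j _ => ?_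
    rw [mul_left_comm, ← Real.exp_add]
    exact mul_le_mul_of_nonneg_left (Real.exp_le_exp.2 (by linarith [hm i j i' j])) (hw j).le
  linarith [Real.exp_le_exp.1 h]

/-- The two distributions share the mass `θ Q`, so only mass `1 - θ` can be moved, over a range of
at most `D`. -/
lemma sum_sub_mul_le {P Q h : Fin n → ℝ} {θ D : ℝ} (hn : 0 < n) (hQ : ∀ j, 0 ≤ Q j)
    (hPsum : ∑ j, P j = 1) (hQsum : ∑ j, Q j = 1) (hPQ : ∀ j, θ * Q j ≤ P j)
    (hD : ∀ j j', h j - h j' ≤ D) : ∑ j, (Q j - P j) * h j ≤ (1 - θ) * D := by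
  have : Nonempty (Fin n) := ⟨⟨0, hn⟩⟩
  obtain ⟨j₀, hj₀⟩ := Finite.exists_min h
  have hθ : θ ≤ 1 := by
    have := Finset.sum_le_sum fun j (_ : j ∈ Finset.univ) => hPQ j
    rw [← Finset.mul_sum, hPsum, hQsum] at this
    linarith
  calc ∑ j, (Q j - P j) * h j = ∑ j, (Q j - P j) * (h j - h j₀) := by
        simp only [mul_sub, Finset.sum_sub_distrib, ← Finset.sum_mul, hPsum, hQsum]
        ring
    _ ≤ ∑ j, (1 - θ) * D * Q j := Finset.sum_le_sum fun j _ => by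
        have h1 : (Q j - P j) * (h j - h j₀) ≤ ((1 - θ) * Q j) * (h j - h j₀) :=
          mul_le_mul_of_nonneg_right (by linarith [hPQ j]) (sub_nonneg.2 (hj₀ j))
        have h2 : ((1 - θ) * Q j) * (h j - h j₀) ≤ ((1 - θ) * Q j) * D :=
          mul_le_mul_of_nonneg_left (hD j j₀) (mul_nonneg (sub_nonneg.2 hθ) (hQ j))
        linarith
    _ = (1 - θ) * D := by rw [← Finset.mul_sum, hQsum, mul_one]

/-- The soft-min transform contracts the oscillation by the factor `1 - exp (-R)`, where `R` is the
oscillation of the cost matrix. -/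
lemma softPot_sub_sub_le (hn : 0 < n) {w : Fin n → ℝ} (hw : ∀ j, 0 < w j) {m : Plan n} {R D : ℝ}
    (hm : ∀ i j i' j', m i j - m i' j' ≤ R) {f g : Fin n → ℝ}
    (hD : ∀ j j', (f j - g j) - (f j' - g j') ≤ D) (i i' : Fin n) :
    (softPot w m f i - softPot w m g i) - (softPot w m f i' - softPot w m g i') ≤
      (1 - Real.exp (-R)) * D := by
  set h : Fin n → ℝ := fun j => f j - g j with hh
  set e : Fin n → ℝ → Fin n → ℝ := fun k s j => w j * Real.exp (g j + s * h j - m k j) with he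
  set Z : Fin n → ℝ → ℝ := fun k s => ∑ j, e k s j with hZ
  have he0 : ∀ k s j, 0 < e k s j := fun k s j => mul_pos (hw j) (Real.exp_pos _)
  have hZ0 : ∀ k s, 0 < Z k s := fun k s => sum_mul_exp_pos hn hw _
  have hderiv : ∀ k s, HasDerivAt (fun s => -Real.log (Z k s))
      (-((∑ j, e k s j * h j) / Z k s)) s := by
    intro k s
    have h1 : ∀ j ∈ Finset.univ, HasDerivAt (fun s => e k s j) (e k s j * h j) s := by
      intro j _
      have h2 : HasDerivAt (fun s : ℝ => g j + s * h j - m k j) (h j) s := by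
        simpa using (((hasDerivAt_id s).mul_const (h j)).const_add (g j)).sub_const (m k j)
      have h3 := h2.exp.const_mul (w j)
      rw [← mul_assoc] at h3
      exact h3
    exact ((HasDerivAt.fun_sum h1).log (hZ0 k s).ne').neg
  -- Along the segment from `g` to `f` the derivative is a difference of expectations of `h` under
  -- two Gibbs measures.
  have hF : ∀ s, HasDerivAt (fun s => -Real.log (Z i s) - -Real.log (Z i' s))
      (∑ j, (e i' s j / Z i' s - e i s j / Z i s) * h j) s := by
    intro s
    refine ((hderiv i s).sub (hderiv i' s)).congr_deriv ?_
    simp only [sub_mul, Finset.sum_sub_distrib, Finset.sum_div, div_mul_eq_mul_div]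
    ring
  have hsum1 : ∀ k s, ∑ j, e k s j / Z k s = 1 := fun k s => by
    rw [← Finset.sum_div, div_self (hZ0 k s).ne']
  -- Comparing from the side of the smaller normalizer costs `exp (-R)` for the numerators only;
  -- arbitrary sides would cost `exp (-2R)`.
  have hcomp : ∀ k k' s j, Z k s ≤ Z k' s →
      Real.exp (-R) * (e k' s j / Z k' s) ≤ e k s j / Z k s := by
    intro k k' s j hk
    have h1 : Real.exp (-R) * e k' s j ≤ e k s j := by
      simp only [he]
      rw [mul_left_comm, ← Real.exp_add]
      exact mul_le_mul_of_nonneg_left (Real.exp_le_exp.2 (by linarith [hm k j k' j])) (hw j).le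
    rw [← mul_div_assoc]
    exact div_le_div₀ (he0 k s j).le h1 (hZ0 k s) hk
  have hbound : ∀ s, ∑ j, (e i' s j / Z i' s - e i s j / Z i s) * h j ≤
      (1 - Real.exp (-R)) * D := by
    intro s
    rcases le_total (Z i s) (Z i' s) with hk | hk
    · exact sum_sub_mul_le hn (fun j => (div_pos (he0 i' s j) (hZ0 i' s)).le) (hsum1 i s)
        (hsum1 i' s) (fun j => hcomp i i' s j hk) hD
    · have := sum_sub_mul_le (h := fun j => -h j) (D := D) hn
        (fun j => (div_pos (he0 i s j) (hZ0 i s)).le) (hsum1 i' s)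
        (hsum1 i s) (fun j => hcomp i' i s j hk) (fun j j' => by linarith [hD j' j])
      refine le_trans (le_of_eq ?_) this
      exact Finset.sum_congr rfl fun j _ => by ring
  have hmvt := image_sub_le_mul_sub_of_deriv_le (fun s => (hF s).differentiableAt)
    (fun s => (hF s).deriv ▸ hbound s) zero_le_one
  have h0 : ∀ k, -Real.log (Z k 0) = softPot w m g k := fun k => by
    simp [hZ, he, softPot]
  have h1 : ∀ k, -Real.log (Z k 1) = softPot w m f k := fun k => by
    simp [hZ, he, hh, softPot]
  simp only [h0, h1] at hmvt
  linarith

/-! ### Alternating scaling sequences -/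

/-- The potentials `x t` computed by alternating normalization of the marginals. The weights `w` and
the costs `c` alternate between the two sides. -/
structure IsScalingSeq (w : ℕ → Fin n → ℝ) (c : ℕ → Plan n) (R : ℝ) (x : ℕ → Fin n → ℝ) :
    Prop where
  pos : 0 < n
  weight_pos : ∀ t j, 0 < w t j
  weight_sum : ∀ t, ∑ j, w t j = 1
  weight_periodic : ∀ t, w (t + 2) = w t
  cost_swap : ∀ t i j, c (t + 1) i j = c t j i
  cost_osc : ∀ t i j i' j', c t i j - c t i' j' ≤ R
  zero : x 0 = 0
  succ : ∀ t, x (t + 1) = softPot (w t) (c t) (x t)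

/-- The coupling with potentials `x (t + 1)` and `x t`. -/
noncomputable def scalingCoupling (w : ℕ → Fin n → ℝ) (c : ℕ → Plan n) (x : ℕ → Fin n → ℝ)
    (t : ℕ) : Plan n :=
  fun i j => w (t + 1) i * w t j * Real.exp (x (t + 1) i + x t j - c t i j)

/-- The violation of the second marginal constraint. -/
noncomputable def scalingError (w : ℕ → Fin n → ℝ) (c : ℕ → Plan n) (x : ℕ → Fin n → ℝ)
    (t : ℕ) : ℝ :=
  ∑ j, |∑ i, scalingCoupling w c x t i j - w t j|

/-- The value of the dual objective. -/
noncomputable def scalingDual (w : ℕ → Fin n → ℝ) (x : ℕ → Fin n → ℝ) (t : ℕ) :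
    ℝ :=
  ∑ i, w (t + 1) i * x (t + 1) i + ∑ j, w t j * x t j

namespace IsScalingSeq

variable {w : ℕ → Fin n → ℝ} {c : ℕ → Plan n} {R : ℝ} {x : ℕ → Fin n → ℝ}

lemma osc_nonneg (h : IsScalingSeq w c R x) : 0 ≤ R := by
  have := h.cost_osc 0 ⟨0, h.pos⟩ ⟨0, h.pos⟩ ⟨0, h.pos⟩ ⟨0, h.pos⟩
  linarith

lemma exp_neg_succ (h : IsScalingSeq w c R x) (t : ℕ) (i : Fin n) :
    Real.exp (-x (t + 1) i) = ∑ j, w t j * Real.exp (x t j - c t i j) := by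
  rw [h.succ, exp_neg_softPot h.pos (h.weight_pos t)]

lemma osc_le (h : IsScalingSeq w c R x) (t : ℕ) (i i' : Fin n) : x t i - x t i' ≤ R := by
  rcases t with _ | t
  · simpa [h.zero] using h.osc_nonneg
  · rw [h.succ]
    exact softPot_sub_le h.pos (h.weight_pos t) (h.cost_osc t) _ _ _

lemma coupling_pos (h : IsScalingSeq w c R x) (t : ℕ) (i j : Fin n) :
    0 < scalingCoupling w c x t i j :=
  mul_pos (mul_pos (h.weight_pos _ _) (h.weight_pos _ _)) (Real.exp_pos _)

lemma sum_coupling_row (h : IsScalingSeq w c R x) (t : ℕ) (i : Fin n) :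
    ∑ j, scalingCoupling w c x t i j = w (t + 1) i := by
  have : ∀ j, scalingCoupling w c x t i j =
      w (t + 1) i * Real.exp (x (t + 1) i) * (w t j * Real.exp (x t j - c t i j)) := fun j => by
    rw [scalingCoupling, add_sub_assoc, Real.exp_add]; ring
  simp only [this]
  rw [← Finset.mul_sum, ← h.exp_neg_succ, mul_assoc, ← Real.exp_add]
  simp

/-- `x (t + 2)` is the potential that would make these columns exact, so its increment measures the
defect. -/
lemma sum_coupling_col (h : IsScalingSeq w c R x) (t : ℕ) (j : Fin n) :
    ∑ i, scalingCoupling w c x t i j = w t j * Real.exp (x t j - x (t + 2) j) := by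
  have : ∀ i, scalingCoupling w c x t i j =
      w t j * Real.exp (x t j) * (w (t + 1) i * Real.exp (x (t + 1) i - c (t + 1) j i)) :=
    fun i => by
      rw [scalingCoupling, h.cost_swap, add_sub_right_comm, Real.exp_add]; ring
  simp only [this]
  rw [← Finset.mul_sum, ← h.exp_neg_succ (t + 1), mul_assoc, ← Real.exp_add]
  rfl

lemma sum_coupling (h : IsScalingSeq w c R x) (t : ℕ) :
    ∑ i, ∑ j, scalingCoupling w c x t i j = 1 := by
  simp only [h.sum_coupling_row, h.weight_sum]

lemma sum_weight_mul_exp (h : IsScalingSeq w c R x) (t : ℕ) :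
    ∑ j, w t j * Real.exp (x t j - x (t + 2) j) = 1 := by
  rw [← h.sum_coupling t, Finset.sum_comm]
  simp only [h.sum_coupling_col]

/-- `exp (-x (t+1) i)` is an average of exponentials whose exponents differ by at most `2R`: one `R`
from `x t`, one from the cost. This bounds the coupling below relative to the product of its
weights. -/
lemma neg_two_mul_le (h : IsScalingSeq w c R x) (t : ℕ) (i j : Fin n) :
    -(2 * R) ≤ x (t + 1) i + x t j - c t i j := by
  have h1 : Real.exp (-x (t + 1) i) ≤ Real.exp (x t j - c t i j + 2 * R) := by
    rw [h.exp_neg_succ]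
    calc _ ≤ ∑ j', w t j' * Real.exp (x t j - c t i j + 2 * R) :=
          Finset.sum_le_sum fun j' _ => mul_le_mul_of_nonneg_left (Real.exp_le_exp.2 (by
            linarith [h.osc_le t j' j, h.cost_osc t i j i j'])) (h.weight_pos t j').le
      _ = _ := by rw [← Finset.sum_mul, h.weight_sum, one_mul]
  linarith [Real.exp_le_exp.1 h1]

/-- Two potentials two indices apart pass through the same transform, so each further index
contracts their difference. Since `x 0 = 0`, the initial oscillation is that of `x 2`. -/
lemma increment_osc_le (h : IsScalingSeq w c R x) (t : ℕ) : ∀ j j' : Fin n,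
    (x (t + 2) j - x t j) - (x (t + 2) j' - x t j') ≤ (1 - Real.exp (-R)) ^ t * R := by
  induction t with
  | zero =>
    intro j j'
    have := h.osc_le 2 j j'
    simpa [h.zero] using this
  | succ t ih =>
    intro j j'
    have hw : softPot (w t) (c t) (x (t + 2)) = softPot (w (t + 2)) (c (t + 2)) (x (t + 2)) := by
      have : c (t + 2) = c t := by
        funext i j; rw [h.cost_swap, h.cost_swap]
      rw [h.weight_periodic, this]
    have h1 := softPot_sub_sub_le h.pos (h.weight_pos t) (h.cost_osc t) ih j j'
    rw [hw, ← h.succ, ← h.succ] at h1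
    rw [pow_succ', mul_assoc]
    exact h1

lemma error_eq (h : IsScalingSeq w c R x) (t : ℕ) :
    scalingError w c x t = ∑ j, w t j * |Real.exp (x t j - x (t + 2) j) - 1| := by
  refine Finset.sum_congr rfl fun j _ => ?_
  rw [h.sum_coupling_col, ← mul_sub_one, abs_mul, abs_of_pos (h.weight_pos t j)]

lemma error_nonneg (w : ℕ → Fin n → ℝ) (c : ℕ → Plan n) (x : ℕ → Fin n → ℝ) (t : ℕ) :
    0 ≤ scalingError w c x t := Finset.sum_nonneg fun _ _ => abs_nonneg _

/-- Linear convergence. -/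
lemma error_le (h : IsScalingSeq w c R x) (t : ℕ) :
    scalingError w c x t ≤ 2 * ((1 - Real.exp (-R)) ^ t * R) := by
  have : Nonempty (Fin n) := ⟨⟨0, h.pos⟩⟩
  set D := (1 - Real.exp (-R)) ^ t * R
  set d : Fin n → ℝ := fun j => x (t + 2) j - x t j with hd
  have hexp : ∀ j, Real.exp (x t j - x (t + 2) j) = Real.exp (-d j) := fun j => by
    simp [hd]
  have hsum := h.sum_weight_mul_exp t
  simp only [hexp] at hsum
  -- The weighted mean of `exp (-d)` is one, so `d` cannot be positive everywhere; the oscillation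
  -- bound becomes a one-sided bound.
  have hmin : ∃ j, d j ≤ 0 := by
    by_contra! hcon
    have : ∑ j, w t j * Real.exp (-d j) < ∑ j, w t j :=
      Finset.sum_lt_sum_of_nonempty Finset.univ_nonempty fun j _ => by
        have : Real.exp (-d j) < 1 := by
          rw [← Real.exp_zero]; exact Real.exp_lt_exp.2 (by linarith [hcon j])
        nlinarith [h.weight_pos t j]
    rw [hsum, h.weight_sum] at this
    exact lt_irrefl _ this
  obtain ⟨j₀, hj₀⟩ := hmin
  have hdD : ∀ j, d j ≤ D := fun j => by
    have := h.increment_osc_le t j j₀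
    linarith
  have hD0 : 0 ≤ D := by simpa using h.increment_osc_le t j₀ j₀
  -- Only the negative part needs a bound, `1 - exp (-d) ≤ d ≤ D`; the signed part averages to zero.
  have hterm : ∀ j, w t j * |Real.exp (-d j) - 1| ≤
      w t j * (Real.exp (-d j) - 1) + w t j * (2 * D) :=
    fun j => by
      rw [← mul_add]
      refine mul_le_mul_of_nonneg_left ?_ (h.weight_pos t j).le
      have h1 := Real.add_one_le_exp (-d j)
      have h2 := hdD j
      exact abs_le.2 ⟨by linarith, by linarith⟩
  rw [h.error_eq]
  simp only [hexp]
  refine (Finset.sum_le_sum fun j _ => hterm j).trans (le_of_eq ?_)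
  simp only [Finset.sum_add_distrib, mul_sub, Finset.sum_sub_distrib, hsum, ← Finset.sum_mul,
    mul_one, h.weight_sum]
  ring

/-- The dual increment `∑ w d` is the divergence of `w` from the current column sums. It dominates
their squared Hellinger distance `∑ w (s - 1)²`, and Cauchy-Schwarz compares this with the `ℓ₁`
distance. -/
lemma error_sq_le (h : IsScalingSeq w c R x) (t : ℕ) :
    scalingError w c x t ^ 2 / 4 ≤ scalingDual w x (t + 1) - scalingDual w x t := by
  set d : Fin n → ℝ := fun j => x (t + 2) j - x t j with hd
  set s : Fin n → ℝ := fun j => Real.exp (-d j / 2) with hs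
  have hs2 : ∀ j, Real.exp (x t j - x (t + 2) j) = s j ^ 2 := fun j => by
    rw [hs, ← Real.exp_nat_mul]; congr 1; simp only [hd]; push_cast; ring
  have hs0 : ∀ j, 0 < s j := fun j => Real.exp_pos _
  have hsum := h.sum_weight_mul_exp t
  simp only [hs2] at hsum
  have hw := h.weight_sum t
  have hdual : scalingDual w x (t + 1) - scalingDual w x t = ∑ j, w t j * d j := by
    have hper : w (t + 1 + 1) = w t := h.weight_periodic t
    simp only [scalingDual, hper, hd, mul_sub, Finset.sum_sub_distrib]
    ring
  have h1 : ∑ j, w t j * (s j - 1) ^ 2 ≤ ∑ j, w t j * d j := by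
    have h2 : ∑ j, w t j * (s j - 1) ^ 2 = ∑ j, w t j * (2 - 2 * s j) := by
      have : ∀ j, w t j * (s j - 1) ^ 2 =
        w t j * s j ^ 2 - w t j + w t j * (2 - 2 * s j) := fun j => by ring
      simp only [this, Finset.sum_add_distrib, Finset.sum_sub_distrib, hsum, hw]
      ring
    rw [h2]
    refine Finset.sum_le_sum fun j _ => mul_le_mul_of_nonneg_left ?_ (h.weight_pos t j).le
    have := Real.add_one_le_exp (-d j / 2)
    simp only [hs]
    linarith
  have h3 : ∑ j, w t j * (s j + 1) ^ 2 ≤ 4 := by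
    have : ∑ j, w t j * (s j + 1) ^ 2 ≤ ∑ j, (2 * (w t j * s j ^ 2) + 2 * w t j) :=
      Finset.sum_le_sum fun j _ => by
        have := mul_nonneg (h.weight_pos t j).le (sq_nonneg (s j - 1))
        nlinarith
    rw [Finset.sum_add_distrib, ← Finset.mul_sum, ← Finset.mul_sum, hsum, hw] at this
    linarith
  have hcs : (∑ j, w t j * |s j ^ 2 - 1|) ^ 2 ≤
      (∑ j, w t j * (s j - 1) ^ 2) * ∑ j, w t j * (s j + 1) ^ 2 := by
    refine Finset.sum_sq_le_sum_mul_sum_of_sq_le_mul _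
      (fun j _ => mul_nonneg (h.weight_pos t j).le (sq_nonneg _))
      (fun j _ => mul_nonneg (h.weight_pos t j).le (sq_nonneg _)) (fun j _ => le_of_eq ?_)
    rw [mul_pow, sq_abs]
    ring
  rw [h.error_eq, hdual]
  simp only [hs2]
  have h4 : 0 ≤ ∑ j, w t j * (s j - 1) ^ 2 :=
    Finset.sum_nonneg fun j _ => mul_nonneg (h.weight_pos t j).le (sq_nonneg _)
  nlinarith

lemma dual_mono (h : IsScalingSeq w c R x) : Monotone (scalingDual w x) :=
  monotone_nat_of_le_succ fun t => by
    have := h.error_sq_le t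
    nlinarith [sq_nonneg (scalingError w c x t)]

/-- Concavity of the dual: the gain is at most the gradient times the displacement. The gradient
vanishes on the exact side, and on the other the displacement oscillates by at most `2R`. Comparing
with a later iterate of equal parity makes a dual maximizer unnecessary. -/
lemma dual_sub_le_of_even (h : IsScalingSeq w c R x) (t k : ℕ) :
    scalingDual w x (t + 2 * k) - scalingDual w x t ≤ 2 * R * scalingError w c x t := by
  set s := t + 2 * k with hs
  have hw : ∀ t, w (t + 2 * k) = w t := by
    intro t
    induction k generalizing t with
    | zero => rfl
    | succ k ih => rw [← h.weight_periodic t, ← ih rfl (t + 2)]; congr 1; ring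
  have hc : c s = c t := by
    have : ∀ k, c (t + 2 * k) = c t := by
      intro k
      induction k with
      | zero => rfl
      | succ k ih =>
        rw [← ih]; funext i j
        rw [show t + 2 * (k + 1) = t + 2 * k + 1 + 1 by ring, h.cost_swap, h.cost_swap]
    exact this k
  have hws : w s = w t := hw t
  have hws1 : w (s + 1) = w (t + 1) := by rw [← hw (t + 1)]; congr 1; omega
  set a : Fin n → ℝ := fun i => x (s + 1) i - x (t + 1) i with ha
  set b : Fin n → ℝ := fun j => x s j - x t j with hb
  set G := scalingCoupling w c x t with hG
  have hgibbs : ∑ i, ∑ j, G i j * (a i + b j) ≤ 0 := by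
    have h1 : ∀ i j, G i j * (a i + b j) ≤ scalingCoupling w c x s i j - G i j := by
      intro i j
      have h2 : scalingCoupling w c x s i j = G i j * Real.exp (a i + b j) := by
        simp only [hG, scalingCoupling, hc, hws, hws1]
        rw [mul_assoc (w (t + 1) i * w t j), ← Real.exp_add]
        congr 2
        simp only [ha, hb]; ring
      rw [h2]
      nlinarith [h.coupling_pos t i j, Real.add_one_le_exp (a i + b j)]
    calc _ ≤ ∑ i, ∑ j, (scalingCoupling w c x s i j - G i j) :=
          Finset.sum_le_sum fun i _ => Finset.sum_le_sum fun j _ => h1 i j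
      _ = 0 := by simp only [Finset.sum_sub_distrib, hG, h.sum_coupling, sub_self]
  have hsplit : ∑ i, ∑ j, G i j * (a i + b j) =
      ∑ i, w (t + 1) i * a i + ∑ j, (∑ i, G i j) * b j := by
    simp only [mul_add, Finset.sum_add_distrib]
    congr 1
    · exact Finset.sum_congr rfl fun i _ => by rw [← Finset.sum_mul, h.sum_coupling_row]
    · rw [Finset.sum_comm]
      exact Finset.sum_congr rfl fun j _ => by rw [← Finset.sum_mul]
  have hdual : scalingDual w x s - scalingDual w x t =
      ∑ i, w (t + 1) i * a i + ∑ j, w t j * b j := by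
    simp only [scalingDual, hws, hws1, ha, hb, mul_sub, Finset.sum_sub_distrib]
    ring
  let j₀ : Fin n := ⟨0, h.pos⟩
  -- The defects sum to zero, so the displacement matters only up to a constant.
  have hshift : ∑ j, (w t j - ∑ i, G i j) * b j = ∑ j, (w t j - ∑ i, G i j) * (b j - b j₀) := by
    have : ∑ j, (w t j - ∑ i, G i j) = 0 := by
      rw [Finset.sum_sub_distrib, Finset.sum_comm, h.weight_sum, hG, h.sum_coupling, sub_self]
    simp only [mul_sub _ (b _) (b j₀)]
    rw [Finset.sum_sub_distrib, ← Finset.sum_mul, this, zero_mul, sub_zero]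
  have hle : ∑ j, (w t j - ∑ i, G i j) * (b j - b j₀) ≤ 2 * R * scalingError w c x t := by
    rw [scalingError, Finset.mul_sum]
    refine Finset.sum_le_sum fun j _ => ?_
    refine (le_abs_self _).trans ?_
    rw [abs_mul, abs_sub_comm, mul_comm]
    refine mul_le_mul_of_nonneg_right (abs_le.2 ⟨?_, ?_⟩) (abs_nonneg _)
    · have := h.osc_le s j₀ j
      have := h.osc_le t j j₀
      simp only [hb]; linarith
    · have := h.osc_le s j j₀
      have := h.osc_le t j₀ j
      simp only [hb]; linarith
  rw [← hshift] at hle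
  simp only [sub_mul, Finset.sum_sub_distrib] at hle
  linarith

lemma dual_sub_le (h : IsScalingSeq w c R x) {t s : ℕ} (hts : t ≤ s) :
    scalingDual w x s - scalingDual w x t ≤ 2 * R * scalingError w c x t := by
  obtain ⟨m, rfl⟩ := Nat.exists_eq_add_of_le hts
  rcases Nat.even_or_odd' m with ⟨k, rfl | rfl⟩
  · exact h.dual_sub_le_of_even t k
  · have h1 := h.dual_sub_le_of_even t (k + 1)
    have h2 := h.dual_mono (show t + (2 * k + 1) ≤ t + 2 * (k + 1) by omega)
    linarith

/-- Sublinear convergence. -/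
lemma exists_error_le (h : IsScalingSeq w c R x) {R' δ : ℝ} (hR : 0 < R') (hRR : R ≤ R')
    (hδ : 0 < δ) : ∃ t : ℕ, (t : ℝ) ≤ 36 * R' / δ ∧ scalingError w c x t ≤ δ := by
  by_contra! hcon
  set S := ⌊36 * R' / δ⌋₊ + 1 with hS
  have hSlt : 36 * R' / δ < S := by rw [hS]; push_cast; exact Nat.lt_floor_add_one _
  have herr : ∀ t < S, δ < scalingError w c x t := fun t ht =>
    hcon t (le_trans (Nat.cast_le.2 (Nat.lt_succ_iff.1 ht)) (Nat.floor_le (by positivity)))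
  -- While the error exceeds `δ`, one has `g ≤ 3 R' err`, and `g` drops by at least `err²/4`, so
  -- `1/g` grows by at least `1/(36 R'²)`. The offset `R' δ` keeps `g` positive and caps `1/g` at
  -- the end.
  set g : ℕ → ℝ := fun t => scalingDual w x S - scalingDual w x t + R' * δ with hg
  have hRδ : 0 < R' * δ := by positivity
  have hg0 : ∀ t ≤ S, R' * δ ≤ g t := fun t ht => by
    have := h.dual_mono ht
    simp only [hg]; linarith
  have hstep : ∀ t < S, (36 * R' ^ 2)⁻¹ ≤ (g (t + 1))⁻¹ - (g t)⁻¹ := by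
    intro t ht
    have h1 := hg0 t ht.le
    have h2 := hg0 (t + 1) ht
    have he := herr t ht
    have he0 : 0 < scalingError w c x t := hδ.trans he
    have h3 : scalingError w c x t ^ 2 / 4 ≤ g t - g (t + 1) := by
      have := h.error_sq_le t
      simp only [hg]; linarith
    have h4 : g t ≤ 3 * R' * scalingError w c x t := by
      have h5 := h.dual_sub_le ht.le
      have h6 : R * scalingError w c x t ≤ R' * scalingError w c x t :=
        mul_le_mul_of_nonneg_right hRR he0.le
      have h7 : R' * δ ≤ R' * scalingError w c x t := mul_le_mul_of_nonneg_left he.le hR.le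
      simp only [hg]; linarith
    have hgt : 0 < g t := hRδ.trans_le h1
    have hgt1 : 0 < g (t + 1) := hRδ.trans_le h2
    have h8 : (g (t + 1))⁻¹ - (g t)⁻¹ = (g t - g (t + 1)) / (g t * g (t + 1)) := by
      field_simp
    rw [h8, le_div_iff₀ (by positivity), inv_mul_le_iff₀ (by positivity)]
    have h9 : g t * g (t + 1) ≤ g t * g t :=
      mul_le_mul_of_nonneg_left (by nlinarith) hgt.le
    have h10 : g t * g t ≤ (3 * R' * scalingError w c x t) * (3 * R' * scalingError w c x t) :=
      mul_le_mul h4 h4 hgt.le (by positivity)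
    have h11 := mul_le_mul_of_nonneg_left h3 (by positivity : 0 ≤ 36 * R' ^ 2)
    nlinarith
  have hsum := Finset.sum_le_sum fun t (ht : t ∈ Finset.range S) =>
    hstep t (Finset.mem_range.1 ht)
  rw [Finset.sum_range_sub (fun t => (g t)⁻¹)] at hsum
  simp only [Finset.sum_const, Finset.card_range, nsmul_eq_mul] at hsum
  have hgS : (g S)⁻¹ = (R' * δ)⁻¹ := by simp [hg]
  have hg00 : 0 ≤ (g 0)⁻¹ := inv_nonneg.2 (hRδ.le.trans (hg0 0 (Nat.zero_le _)))
  have hfin : (S : ℝ) * (36 * R' ^ 2)⁻¹ ≤ (R' * δ)⁻¹ := by rw [hgS] at hsum; linarith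
  rw [← div_eq_mul_inv, div_le_iff₀ (by positivity)] at hfin
  have : (R' * δ)⁻¹ * (36 * R' ^ 2) = 36 * R' / δ := by field_simp
  linarith

end IsScalingSeq

end ProxSinkhorn
namespace ProxSinkhorn

/-! ### Rounding -/

variable {n : ℕ}

/-- The rounding to `U(a, b)` of a matrix `G` with row sums `a`. -/
noncomputable def roundCols (a b : Fin n → ℝ) (G : Plan n) : Plan n :=
  let F : Plan n := fun i j => G i j * min (b j / ∑ i, G i j) 1
  fun i j => F i j + (a i - ∑ j, F i j) * (b j - ∑ i, F i j) / ∑ i, (a i - ∑ j, F i j)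

section Round

variable {a b : Fin n → ℝ} {G : Plan n}

lemma mul_min_div_one {b c : ℝ} (hc : 0 < c) : c * min (b / c) 1 = min b c := by
  rw [mul_min_of_nonneg _ _ hc.le, mul_div_cancel₀ _ hc.ne', mul_one]

lemma sub_min_eq (b c : ℝ) : b - min b c = (|c - b| + (b - c)) / 2 := by
  rcases le_total b c with h | h
  · rw [min_eq_left h, abs_of_nonneg (sub_nonneg.2 h)]; ring
  · rw [min_eq_right h, abs_of_nonpos (sub_nonpos.2 h)]; ring

lemma mul_neg_log_min_div_one_le {b c : ℝ} (hb : 0 < b) (hc : 0 < c) :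
    b * -Real.log (min (b / c) 1) ≤ (|c - b| + (c - b)) / 2 := by
  rcases le_total b c with h | h
  · rw [min_eq_left ((div_le_one hc).2 h), abs_of_nonneg (sub_nonneg.2 h)]
    have := sub_le_mul_log_div hc hb
    linarith
  · rw [min_eq_right ((one_le_div hc).2 h), abs_of_nonpos (sub_nonpos.2 h)]
    simp

/-- The rounded plan is close to `G`, both in divergence and in the logarithm. -/
lemma roundCols_spec (ha : a ∈ stdSimplex ℝ (Fin n)) (hb : b ∈ stdSimplex ℝ (Fin n))
    (hb0 : ∀ j, 0 < b j) (hG : ∀ i j, 0 < G i j)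
    (hrow : ∀ i, ∑ j, G i j = a i) {K : ℝ}
    (hK : ∀ i j, a i * b j * Real.exp (-K) ≤ G i j) {δ : ℝ}
    (hδ : ∑ j, |∑ i, G i j - b j| = δ) :
    roundCols a b G ∈ polytope a b ∧ (∀ i j, 0 < roundCols a b G i j) ∧
    (∀ s, 0 < s → ∑ i, ∑ j, roundCols a b G i j * Real.log (roundCols a b G i j / G i j) ≤
      δ / 2 * (K - Real.log s) + n * s) ∧
    ∀ y ∈ polytope a b,
      ∑ i, ∑ j, y i j * Real.log (G i j / roundCols a b G i j) ≤ δ / 2 := by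
  have hne : Nonempty (Fin n) := by
    by_contra hne
    have := hb.2
    rw [not_nonempty_iff] at hne
    simp at this
  set c : Fin n → ℝ := fun j => ∑ i, G i j with hc
  have hc0 : ∀ j, 0 < c j := fun j => Finset.sum_pos (fun i _ => hG i j) Finset.univ_nonempty
  have hcsum : ∑ j, c j = 1 := by
    simp only [hc]; rw [Finset.sum_comm]; simp only [hrow, ha.2]
  set z : Fin n → ℝ := fun j => min (b j / c j) 1 with hz
  have hz0 : ∀ j, 0 < z j := fun j => lt_min (div_pos (hb0 j) (hc0 j)) one_pos
  have hz1 : ∀ j, z j ≤ 1 := fun j => min_le_right _ _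
  set F : Plan n := fun i j => G i j * z j with hF
  have hF0 : ∀ i j, 0 < F i j := fun i j => mul_pos (hG i j) (hz0 j)
  have hFG : ∀ i j, F i j ≤ G i j := fun i j => mul_le_of_le_one_right (hG i j).le (hz1 j)
  have hFrow : ∀ i, ∑ j, F i j ≤ a i := fun i => by
    rw [← hrow i]; exact Finset.sum_le_sum fun j _ => hFG i j
  have hFcol : ∀ j, ∑ i, F i j = min (b j) (c j) := fun j => by
    rw [← mul_min_div_one (hc0 j), ← Finset.sum_mul]
  have hmem := add_rankOne_mem_polytope (fun i j => (hF0 i j).le) hFrow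
    (fun j => (hFcol j).trans_le (min_le_left _ _)) (ha.2.trans hb.2.symm)
  set E : Plan n := fun i j => (a i - ∑ j, F i j) * (b j - ∑ i, F i j) /
    ∑ i, (a i - ∑ j, F i j) with hE
  have hπ : roundCols a b G = fun i j => F i j + E i j := rfl
  have hE0 : ∀ i j, 0 ≤ E i j := fun i j =>
    div_nonneg (mul_nonneg (sub_nonneg.2 (hFrow i))
      (sub_nonneg.2 ((hFcol j).trans_le (min_le_left _ _))))
      (Finset.sum_nonneg fun i _ => sub_nonneg.2 (hFrow i))
  set t : Fin n → ℝ := fun j => ∑ i, E i j with ht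
  have ht_eq : ∀ j, t j = (|c j - b j| + (b j - c j)) / 2 := fun j => by
    rw [← sub_min_eq, ← hFcol j]
    have := hmem.2.2 j
    rw [Finset.sum_add_distrib] at this
    simp only [ht]
    linarith
  have htsum : ∑ j, t j = δ / 2 := by
    simp only [ht_eq]
    rw [← Finset.sum_div, Finset.sum_add_distrib, Finset.sum_sub_distrib, hb.2, hcsum, hδ]
    ring
  have ht0 : ∀ j, 0 ≤ t j := fun j => Finset.sum_nonneg fun i _ => hE0 i j
  have htb : ∀ j, t j ≤ b j := fun j => by
    rw [ht_eq, ← sub_min_eq]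
    linarith [le_min (hb0 j).le (hc0 j).le]
  refine ⟨hmem, fun i j => add_pos_of_pos_of_nonneg (hF0 i j) (hE0 i j), fun s hs => ?_,
    fun y hy => ?_⟩
  -- Split the plan as `F + E`: the logarithm weighted by `F` costs at most `E`, and the one
  -- weighted by `E` uses `F + E ≤ a i` together with the lower bound on `G`.
  · have hterm : ∀ i j, roundCols a b G i j * Real.log (roundCols a b G i j / G i j) ≤
        E i j + E i j * (K - Real.log (b j)) := by
      intro i j
      rw [hπ]
      have h0 : 0 < F i j + E i j := add_pos_of_pos_of_nonneg (hF0 i j) (hE0 i j)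
      have h1 : F i j * Real.log ((F i j + E i j) / G i j) ≤ E i j := by
        have h2 : Real.log ((F i j + E i j) / G i j) ≤ (F i j + E i j) / F i j - 1 :=
          (Real.log_le_log (div_pos h0 (hG i j))
            (div_le_div_of_nonneg_left h0.le (hF0 i j) (hFG i j))).trans
            (Real.log_le_sub_one_of_pos (div_pos h0 (hF0 i j)))
        have h3 := mul_le_mul_of_nonneg_left h2 (hF0 i j).le
        have h4 : F i j * ((F i j + E i j) / F i j - 1) = E i j := by
          have := (hF0 i j).ne'
          field_simp
          ring
        linarith
      have h5 : Real.log ((F i j + E i j) / G i j) ≤ K - Real.log (b j) := by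
        have h6 : (F i j + E i j) / G i j ≤ Real.exp K / b j := by
          rw [div_le_div_iff₀ (hG i j) (hb0 j)]
          have h7 : F i j + E i j ≤ a i := le_row_of_mem_polytope hmem i j
          have h8 : a i * b j ≤ Real.exp K * G i j := by
            have := mul_le_mul_of_nonneg_left (hK i j) (Real.exp_pos K).le
            rw [mul_left_comm, ← Real.exp_add] at this
            simpa using this
          exact (mul_le_mul_of_nonneg_right h7 (hb0 j).le).trans h8
        have h9 := Real.log_le_log (div_pos h0 (hG i j)) h6
        rwa [Real.log_div (Real.exp_pos K).ne' (hb0 j).ne', Real.log_exp] at h9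
      have h10 := mul_le_mul_of_nonneg_left h5 (hE0 i j)
      rw [add_mul]
      linarith
    -- The added column mass satisfies `t j ≤ b j`, so `-ln (b j)` is replaced by `-ln (t j)` and
    -- the tangent of `t ln t` at `s` removes the dependence on small marginals.
    have hcolterm : ∀ j, t j + t j * (K - Real.log (b j)) ≤ t j * (K - Real.log s) + s := by
      intro j
      rcases (ht0 j).eq_or_lt with h0 | h0
      · rw [← h0]; simpa using hs.le
      · have h1 := sub_le_mul_log_div hs h0
        rw [Real.log_div h0.ne' hs.ne'] at h1
        have h2 := mul_le_mul_of_nonneg_left (Real.log_le_log h0 (htb j)) h0.le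
        linarith
    calc _ ≤ ∑ i, ∑ j, (E i j + E i j * (K - Real.log (b j))) :=
          Finset.sum_le_sum fun i _ => Finset.sum_le_sum fun j _ => hterm i j
      _ = ∑ j, (t j + t j * (K - Real.log (b j))) := by
          rw [Finset.sum_comm]
          simp only [Finset.sum_add_distrib, ht, Finset.sum_mul]
      _ ≤ ∑ j, (t j * (K - Real.log s) + s) := Finset.sum_le_sum fun j _ => hcolterm j
      _ = _ := by
          rw [Finset.sum_add_distrib, ← Finset.sum_mul, htsum]
          simp
  -- Adding `E` can only increase the plan, so `G` exceeds it at most by the factor `1 / z j`.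
  · have hterm : ∀ i j, y i j * Real.log (G i j / roundCols a b G i j) ≤
        y i j * -Real.log (z j) := by
      intro i j
      refine mul_le_mul_of_nonneg_left ?_ (hy.1 i j)
      rw [hπ, ← Real.log_inv]
      have h0 : 0 < F i j + E i j := add_pos_of_pos_of_nonneg (hF0 i j) (hE0 i j)
      refine Real.log_le_log (div_pos (hG i j) h0) ?_
      rw [div_le_iff₀ h0, inv_mul_eq_div, le_div_iff₀ (hz0 j)]
      exact le_add_of_nonneg_right (hE0 i j)
    calc _ ≤ ∑ i, ∑ j, y i j * -Real.log (z j) :=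
          Finset.sum_le_sum fun i _ => Finset.sum_le_sum fun j _ => hterm i j
      _ = ∑ j, b j * -Real.log (z j) := by
          rw [Finset.sum_comm]
          simp only [← Finset.sum_mul, hy.2.2]
      _ ≤ ∑ j, (|c j - b j| + (c j - b j)) / 2 := Finset.sum_le_sum fun j _ =>
          mul_neg_log_min_div_one_le (hb0 j) (hc0 j)
      _ = δ / 2 := by
          rw [← Finset.sum_div, Finset.sum_add_distrib, Finset.sum_sub_distrib, hb.2, hcsum, hδ]
          ring

end Round

lemma roundPlan_of_rowSums {p q : Fin n → ℝ} {B : Plan n} (hp : ∀ i, 0 < p i)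
    (hB : ∀ i j, 0 < B i j) (hrow : ∀ i, ∑ j, B i j = p i) :
    (roundPlan p q B).val = roundCols p q B := by
  have h1 : ∀ i, min (p i / p i) 1 = 1 := fun i => by rw [div_self (hp i).ne', min_self]
  rw [roundPlan_val]
  simp only [hrow, h1, one_mul, roundCols]
  have h2 : ∀ i, |p i - ∑ j, B i j * min (q j / ∑ i, B i j) 1| =
      p i - ∑ j, B i j * min (q j / ∑ i, B i j) 1 := fun i => by
    refine abs_of_nonneg (sub_nonneg.2 ?_)
    rw [← hrow i]
    exact Finset.sum_le_sum fun j _ => mul_le_of_le_one_right (hB i j).le (min_le_right _ _)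
  simp only [h2]

/-- Scaling rows down only lowers the columns, so the column scaling is trivial and the rounding is
the transposed one-sided rounding. -/
lemma roundPlan_of_colSums {p q : Fin n → ℝ} {B : Plan n} (hp : ∀ i, 0 < p i)
    (hpq : ∑ i, p i = ∑ j, q j)
    (hB : ∀ i j, 0 < B i j) (hcol : ∀ j, ∑ i, B i j = q j) (i j : Fin n) :
    (roundPlan p q B).val i j = roundCols q p (fun j i => B i j) j i := by
  set x : Fin n → ℝ := fun i => min (p i / ∑ j, B i j) 1 with hx
  have hx1 : ∀ i, x i ≤ 1 := fun i => min_le_right _ _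
  have hr0 : ∀ i, 0 < ∑ j, B i j := fun i =>
    Finset.sum_pos (fun j _ => hB i j) ⟨i, Finset.mem_univ i⟩
  have hx0 : ∀ i, 0 < x i := fun i => lt_min (div_pos (hp i) (hr0 i)) one_pos
  have hcolF : ∀ j, ∑ i, x i * B i j ≤ q j := fun j => by
    rw [← hcol j]
    exact Finset.sum_le_sum fun i _ => mul_le_of_le_one_left (hB i j).le (hx1 i)
  have hcolF0 : ∀ j, 0 < ∑ i, x i * B i j := fun j =>
    Finset.sum_pos (fun i _ => mul_pos (hx0 i) (hB i j)) ⟨j, Finset.mem_univ j⟩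
  have hy : ∀ j, min (q j / ∑ i, x i * B i j) 1 = 1 := fun j =>
    min_eq_right ((one_le_div (hcolF0 j)).2 (hcolF j))
  have hrowF : ∀ i, ∑ j, x i * B i j ≤ p i := fun i => by
    rw [← Finset.mul_sum, mul_comm]
    exact (mul_min_div_one (hr0 i)).trans_le (min_le_left _ _)
  have habs : ∀ i, |p i - ∑ j, x i * B i j| = p i - ∑ j, x i * B i j := fun i =>
    abs_of_nonneg (sub_nonneg.2 (hrowF i))
  have hmass : ∑ i, (p i - ∑ j, x i * B i j) = ∑ j, (q j - ∑ i, x i * B i j) := by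
    rw [Finset.sum_sub_distrib, Finset.sum_sub_distrib, hpq, Finset.sum_comm]
  rw [roundPlan_val]
  have hx' : ∀ i, min (p i / ∑ j, B i j) 1 = x i := fun i => rfl
  simp only [hx', hy, mul_one, habs, roundCols, mul_comm _ (x _)]
  rw [hmass, mul_comm (p i - _)]

/-! ### From the scaled kernel to the proximal objective -/

section Objective

variable {p q : Fin n → ℝ} {C ρ B : Plan n} {L : ℝ} {u v : Fin n → ℝ}

lemma log_scaled (hL : 0 < L)
    (hB : ∀ i j, B i j = Real.exp (u i + v j - (C i j - L * Real.log (ρ i j)) / L))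
    (i j : Fin n) : L * Real.log (B i j) = L * u i + L * v j - C i j + L * Real.log (ρ i j) := by
  rw [hB, Real.log_exp]
  field_simp
  ring

/-- `B` differs from the Gibbs kernel by row and column factors, whose logarithms integrate to
constants under fixed marginals. -/
lemma proxObjective_eq_of_scaled (hL : 0 < L) (hρ : ∀ i j, 0 < ρ i j)
    (hB : ∀ i j, B i j = Real.exp (u i + v j - (C i j - L * Real.log (ρ i j)) / L))
    {y : Plan n} (hy : y ∈ polytope p q) :
    proxObjective C L ρ y = L * ∑ i, ∑ j, y i j * Real.log (y i j / B i j) +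
      (L * ∑ i, p i * u i + L * ∑ j, q j * v j) := by
  have hB0 : ∀ i j, B i j ≠ 0 := fun i j => by rw [hB]; exact (Real.exp_pos _).ne'
  have hterm : ∀ i j, C i j * y i j + L * (y i j * Real.log (y i j / ρ i j)) =
      L * (y i j * Real.log (y i j / B i j)) + (L * (y i j * u i) + L * (y i j * v j)) := by
    intro i j
    rcases eq_or_ne (y i j) 0 with h0 | h0
    · simp [h0]
    · rw [Real.log_div h0 (hρ i j).ne', Real.log_div h0 (hB0 i j)]
      have := congrArg (y i j * ·) (log_scaled hL hB i j)
      linarith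
  rw [proxObjective_eq_sum]
  simp only [hterm, Finset.sum_add_distrib, ← Finset.mul_sum]
  have hrow : ∑ i, ∑ j, y i j * u i = ∑ i, p i * u i :=
    Finset.sum_congr rfl fun i _ => by rw [← Finset.sum_mul, hy.2.1]
  have hcol : ∑ i, ∑ j, y i j * v j = ∑ j, q j * v j := by
    rw [Finset.sum_comm]
    exact Finset.sum_congr rfl fun j _ => by rw [← Finset.sum_mul, hy.2.2]
  rw [hrow, hcol]

lemma fderiv_proxObjective_of_scaled (hL : 0 < L) (hρ : ∀ i j, 0 < ρ i j)
    (hB : ∀ i j, B i j = Real.exp (u i + v j - (C i j - L * Real.log (ρ i j)) / L))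
    {x y : Plan n} (hx : x ∈ polytope p q) (hx0 : ∀ i j, 0 < x i j) (hy : y ∈ polytope p q) :
    fderiv ℝ (proxObjective C L ρ) x (x - y) =
      L * (∑ i, ∑ j, x i j * Real.log (x i j / B i j) +
        ∑ i, ∑ j, y i j * Real.log (B i j / x i j)) := by
  have hB0 : ∀ i j, B i j ≠ 0 := fun i j => by rw [hB]; exact (Real.exp_pos _).ne'
  rw [fderiv_proxObjective C L fun i j _ => (hx0 i j).ne']
  have hterm : ∀ i j, (C i j + L * (if ρ i j = 0 then 0 else Real.log (x i j / ρ i j) + 1)) *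
      (x - y) i j = L * (x i j * Real.log (x i j / B i j) + y i j * Real.log (B i j / x i j)) +
        ((x i j * (L * u i + L) - y i j * (L * u i + L)) +
          (x i j * (L * v j) - y i j * (L * v j))) := by
    intro i j
    simp only [(hρ i j).ne', if_false, Pi.sub_apply]
    rw [Real.log_div (hx0 i j).ne' (hρ i j).ne', Real.log_div (hx0 i j).ne' (hB0 i j),
      Real.log_div (hB0 i j) (hx0 i j).ne']
    have := congrArg ((x i j - y i j) * ·) (log_scaled hL hB i j)
    linarith
  have hrow : ∀ f : Fin n → ℝ, ∑ i, ∑ j, x i j * f i = ∑ i, ∑ j, y i j * f i := fun f => by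
    simp only [← Finset.sum_mul, hx.2.1, hy.2.1]
  have hcol : ∀ f : Fin n → ℝ, ∑ i, ∑ j, x i j * f j = ∑ i, ∑ j, y i j * f j := fun f => by
    rw [Finset.sum_comm, Finset.sum_comm (f := fun i j => y i j * f j)]
    simp only [← Finset.sum_mul, hx.2.2, hy.2.2]
  simp only [hterm, Finset.sum_add_distrib, Finset.sum_sub_distrib, ← Finset.mul_sum]
  rw [hrow fun i => L * u i + L, hcol fun j => L * v j]
  ring

/-- A plan close to a scaled kernel is an approximate minimizer. -/
lemma isResidualMin_and_isInexactMin_of_scaled (hL : 0 < L) (hρ : ∀ i j, 0 < ρ i j)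
    (hB : ∀ i j, B i j = Real.exp (u i + v j - (C i j - L * Real.log (ρ i j)) / L))
    (hmass : ∑ i, ∑ j, B i j = ∑ i, p i)
    {x : Plan n} (hx : x ∈ polytope p q) (hx0 : ∀ i j, 0 < x i j) {κ κ' : ℝ}
    (hκ : ∑ i, ∑ j, x i j * Real.log (x i j / B i j) ≤ κ)
    (hκ' : ∀ y ∈ polytope p q, ∑ i, ∑ j, y i j * Real.log (B i j / x i j) ≤ κ') :
    IsResidualMin (polytope p q) (proxObjective C L ρ) (L * κ) x ∧
      IsInexactMin (polytope p q) (proxObjective C L ρ) (L * (κ + κ')) x := by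
  have hB0 : ∀ i j, 0 < B i j := fun i j => by rw [hB]; exact Real.exp_pos _
  refine ⟨⟨hx, fun y hy => ?_⟩, hx,
    (hasFDerivAt_proxObjective C L fun i j _ => (hx0 i j).ne').differentiableAt, fun y hy => ?_⟩
  · rw [proxObjective_eq_of_scaled hL hρ hB hx, proxObjective_eq_of_scaled hL hρ hB hy]
    have h1 : 0 ≤ ∑ i, ∑ j, y i j * Real.log (y i j / B i j) := by
      have h2 : ∀ i j, y i j - B i j ≤ y i j * Real.log (y i j / B i j) := fun i j => by
        rcases (hy.1 i j).eq_or_lt with h0 | h0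
        · rw [← h0]; simpa using (hB0 i j).le
        · exact sub_le_mul_log_div (hB0 i j) h0
      have h3 := Finset.sum_le_sum fun i (_ : i ∈ Finset.univ) =>
        Finset.sum_le_sum fun j (_ : j ∈ Finset.univ) => h2 i j
      simp only [Finset.sum_sub_distrib, hmass, hy.2.1, sub_self] at h3
      exact h3
    have h4 := mul_le_mul_of_nonneg_left hκ hL.le
    have h5 := mul_nonneg hL.le h1
    linarith
  · rw [fderiv_proxObjective_of_scaled hL hρ hB hx hx0 hy]
    exact mul_le_mul_of_nonneg_left (add_le_add hκ (hκ' y hy)) hL.le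

end Objective

end ProxSinkhorn
namespace ProxSinkhorn

/-! ### The iterates of Sinkhorn's algorithm -/

variable {n : ℕ}

/-- The marginal that is matched up to an error by the coupling number `t`. -/
def alternatingWeight (p q : Fin n → ℝ) (t : ℕ) : Fin n → ℝ := if t % 2 = 0 then q else p

/-- The matrix `m` for even `t` and its transpose for odd `t`. -/
def alternatingCost (m : Plan n) (t : ℕ) : Plan n :=
  if t % 2 = 0 then m else fun i j => m j i

/-- The sequence of all potentials computed by Sinkhorn's algorithm. -/
noncomputable def scalingSeq (p q : Fin n → ℝ) (m : Plan n) : ℕ → Fin n → ℝ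
  | 0 => 0
  | t + 1 => softPot (alternatingWeight p q t) (alternatingCost m t) (scalingSeq p q m t)

/-- The potentials after `t` iterations. -/
noncomputable def sinkhornState (p q : Fin n → ℝ) (m : Plan n) (t : ℕ) : Potentials n :=
  (fun i => Real.log (p i) + scalingSeq p q m (2 * ((t + 1) / 2) - 1) i,
    fun j => Real.log (q j) + scalingSeq p q m (2 * (t / 2)) j)

section Alternating

variable (p q : Fin n → ℝ) (m : Plan n) (k : ℕ)

lemma alternatingWeight_even : alternatingWeight p q (2 * k) = q := by simp [alternatingWeight]

lemma alternatingWeight_odd : alternatingWeight p q (2 * k + 1) = p := by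
  have : (2 * k + 1) % 2 = 1 := by omega
  simp [alternatingWeight, this]

lemma alternatingCost_even : alternatingCost m (2 * k) = m := by simp [alternatingCost]

lemma alternatingCost_odd : alternatingCost m (2 * k + 1) = fun i j => m j i := by
  have : (2 * k + 1) % 2 = 1 := by omega
  simp [alternatingCost, this]

lemma sinkhornState_even : sinkhornState p q m (2 * k) =
    (fun i => Real.log (p i) + scalingSeq p q m (2 * k - 1) i,
      fun j => Real.log (q j) + scalingSeq p q m (2 * k) j) := by
  have h1 : (2 * k + 1) / 2 = k := by omega
  have h2 : 2 * k / 2 = k := by omega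
  simp only [sinkhornState, h1, h2]

lemma sinkhornState_odd : sinkhornState p q m (2 * k + 1) =
    (fun i => Real.log (p i) + scalingSeq p q m (2 * k + 1) i,
      fun j => Real.log (q j) + scalingSeq p q m (2 * k) j) := by
  have h1 : 2 * ((2 * k + 1 + 1) / 2) - 1 = 2 * k + 1 := by omega
  have h2 : (2 * k + 1) / 2 = k := by omega
  simp only [sinkhornState, h1, h2]

end Alternating

section Iterates

variable {p q : Fin n → ℝ} {M : Plan n} {γ : ℝ}

lemma isScalingSeq (hn : 0 < n) (hp : p ∈ stdSimplex ℝ (Fin n)) (hq : q ∈ stdSimplex ℝ (Fin n))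
    (hp0 : ∀ i, 0 < p i) (hq0 : ∀ j, 0 < q j) {m : Plan n} {R : ℝ}
    (hm : ∀ i j i' j', m i j - m i' j' ≤ R) :
    IsScalingSeq (alternatingWeight p q) (alternatingCost m) R (scalingSeq p q m) where
  pos := hn
  weight_pos t j := by unfold alternatingWeight; split_ifs; exacts [hq0 j, hp0 j]
  weight_sum t := by unfold alternatingWeight; split_ifs; exacts [hq.2, hp.2]
  weight_periodic t := by simp [alternatingWeight]
  cost_swap t i j := by
    obtain ⟨k, rfl | rfl⟩ := Nat.even_or_odd' t
    · rw [alternatingCost_odd, alternatingCost_even]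
    · rw [alternatingCost_odd, show 2 * k + 1 + 1 = 2 * (k + 1) by ring, alternatingCost_even]
  cost_osc t i j i' j' := by unfold alternatingCost; split_ifs <;> exact hm _ _ _ _
  zero := rfl
  succ t := rfl

lemma exp_mul_exp_mul_exp (a M b γ : ℝ) :
    Real.exp a * Real.exp ((0 - M) / γ) * Real.exp b = Real.exp (a + b - M / γ) := by
  rw [← Real.exp_add, ← Real.exp_add]
  congr 1
  ring

/-- The old potential `a` cancels, so an update depends only on the opposite potential; this lets
both sides be merged into one sequence. -/
lemma add_sub_log_sum_eq (hn : 0 < n) {w : Fin n → ℝ} (hw : ∀ j, 0 < w j) (m : Plan n) (a b : ℝ)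
    (f : Fin n → ℝ) (i : Fin n) :
    a + b - Real.log (∑ j, Real.exp (a + (Real.log (w j) + f j) - m i j)) =
      b + softPot w m f i := by
  have h : ∀ j, Real.exp (a + (Real.log (w j) + f j) - m i j) =
      Real.exp a * (w j * Real.exp (f j - m i j)) := fun j => by
    rw [show a + (Real.log (w j) + f j) - m i j = a + (Real.log (w j) + (f j - m i j)) by ring,
      Real.exp_add, Real.exp_add, Real.exp_log (hw j)]
  simp only [h]
  rw [← Finset.mul_sum, Real.log_mul (Real.exp_pos a).ne' (sum_mul_exp_pos hn hw _).ne',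
    Real.log_exp, softPot]
  ring

lemma sinkhornStep_sinkhornState (hn : 0 < n) (hp0 : ∀ i, 0 < p i) (hq0 : ∀ j, 0 < q j) (t : ℕ) :
    (sinkhornStep (fun i j => Real.exp ((0 - M i j) / γ)) p q t
      (sinkhornState p q (fun i j => M i j / γ) t)).val =
      sinkhornState p q (fun i j => M i j / γ) (t + 1) := by
  obtain ⟨k, rfl | rfl⟩ := Nat.even_or_odd' t
  · rw [sinkhornStep_val_even _ _ _ (by omega), sinkhornState_odd, sinkhornState_even]
    refine Prod.ext (funext fun i => ?_) rfl
    simp only [exp_mul_exp_mul_exp]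
    rw [add_sub_log_sum_eq hn hq0 (fun i j => M i j / γ), scalingSeq, alternatingWeight_even,
      alternatingCost_even]
  · rw [sinkhornStep_val_odd _ _ _ (by omega), show 2 * k + 1 + 1 = 2 * (k + 1) by ring,
      sinkhornState_odd, sinkhornState_even]
    refine Prod.ext rfl (funext fun j => ?_)
    simp only [exp_mul_exp_mul_exp]
    simp only [add_comm (Real.log (p _) + _)]
    have hsucc : scalingSeq p q (fun i j => M i j / γ) (2 * (k + 1)) =
        softPot (alternatingWeight p q (2 * k + 1))
          (alternatingCost (fun i j => M i j / γ) (2 * k + 1))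
          (scalingSeq p q (fun i j => M i j / γ) (2 * k + 1)) := rfl
    rw [add_sub_log_sum_eq hn hp0 (fun i j => M j i / γ), hsucc, alternatingWeight_odd,
      alternatingCost_odd]

lemma scaledKernel_sinkhornState_odd (hp0 : ∀ i, 0 < p i) (hq0 : ∀ j, 0 < q j) (k : ℕ) :
    (scaledKernel (fun i j => Real.exp ((0 - M i j) / γ))
      (sinkhornState p q (fun i j => M i j / γ) (2 * k + 1))).val =
    scalingCoupling (alternatingWeight p q) (alternatingCost fun i j => M i j / γ)
      (scalingSeq p q fun i j => M i j / γ) (2 * k) := by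
  rw [scaledKernel_val, sinkhornState_odd]
  funext i j
  simp only [exp_mul_exp_mul_exp]
  rw [scalingCoupling, alternatingWeight_odd, alternatingWeight_even, alternatingCost_even]
  calc _ = Real.exp (Real.log (p i)) * Real.exp (Real.log (q j)) * _ := by
        rw [← Real.exp_add, ← Real.exp_add]
        congr 1
        exact (by intros; ring : ∀ a b c d e : ℝ, a + b + (c + d) - e = a + c + (b + d - e)) _ _ _ _ _
    _ = _ := by rw [Real.exp_log (hp0 i), Real.exp_log (hq0 j)]

lemma scaledKernel_sinkhornState_even (hp0 : ∀ i, 0 < p i) (hq0 : ∀ j, 0 < q j) (k : ℕ) :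
    (scaledKernel (fun i j => Real.exp ((0 - M i j) / γ))
      (sinkhornState p q (fun i j => M i j / γ) (2 * k + 1 + 1))).val = fun i j =>
    scalingCoupling (alternatingWeight p q) (alternatingCost fun i j => M i j / γ)
      (scalingSeq p q fun i j => M i j / γ) (2 * k + 1) j i := by
  rw [scaledKernel_val, show 2 * k + 1 + 1 = 2 * (k + 1) by ring, sinkhornState_even]
  funext i j
  simp only [exp_mul_exp_mul_exp]
  rw [scalingCoupling, show 2 * k + 1 + 1 = 2 * (k + 1) by ring, alternatingWeight_odd,
    alternatingWeight_even, alternatingCost_odd, show 2 * (k + 1) - 1 = 2 * k + 1 by omega]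
  calc _ = Real.exp (Real.log (q j)) * Real.exp (Real.log (p i)) * _ := by
        rw [← Real.exp_add, ← Real.exp_add]
        congr 1
        exact (by intros; ring : ∀ a b c d e : ℝ, a + b + (c + d) - e = c + a + (d + b - e)) _ _ _ _ _
    _ = _ := by rw [Real.exp_log (hq0 j), Real.exp_log (hp0 i)]

/-- The side just updated is exact, so only one of the two `ℓ₁` errors survives. State `t + 1`
carries coupling `t`. -/
lemma sinkhornTest_sinkhornState_succ (hn : 0 < n) (hp : p ∈ stdSimplex ℝ (Fin n))
    (hq : q ∈ stdSimplex ℝ (Fin n)) (hp0 : ∀ i, 0 < p i) (hq0 : ∀ j, 0 < q j) {R : ℝ}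
    (hm : ∀ i j i' j', M i j / γ - M i' j' / γ ≤ R) (ε' : ℝ) (t : ℕ) :
    (sinkhornTest (fun i j => Real.exp ((0 - M i j) / γ)) p q ε'
      (sinkhornState p q (fun i j => M i j / γ) (t + 1))).val ↔
    scalingError (alternatingWeight p q) (alternatingCost fun i j => M i j / γ)
      (scalingSeq p q fun i j => M i j / γ) t ≤ ε' := by
  have hS := isScalingSeq hn hp hq hp0 hq0 hm
  rw [sinkhornTest_val]
  obtain ⟨k, rfl | rfl⟩ := Nat.even_or_odd' t
  · have hB : ∀ i j, _ = _ := fun i j =>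
      congrFun (congrFun (scaledKernel_sinkhornState_odd (M := M) (γ := γ) hp0 hq0 k) i) j
    simp only [scaledKernel_val] at hB
    simp only [hB, hS.sum_coupling_row, alternatingWeight_odd]
    simp [scalingError, alternatingWeight_even]
  · have hB : ∀ i j, _ = _ := fun i j =>
      congrFun (congrFun (scaledKernel_sinkhornState_even (M := M) (γ := γ) hp0 hq0 k) i) j
    simp only [scaledKernel_val] at hB
    simp only [hB, hS.sum_coupling_row]
    simp only [show 2 * k + 1 + 1 = 2 * (k + 1) by ring, alternatingWeight_even]
    simp [scalingError, alternatingWeight_odd]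

/-- The plan returned after `t + 1` iterations. -/
lemma sinkhornFinish_spec (hn : 0 < n) (hp : p ∈ stdSimplex ℝ (Fin n))
    (hq : q ∈ stdSimplex ℝ (Fin n)) (hp0 : ∀ i, 0 < p i) (hq0 : ∀ j, 0 < q j) {R : ℝ}
    (hm : ∀ i j i' j', M i j / γ - M i' j' / γ ≤ R) (t : ℕ) {δ : ℝ}
    (hδ : scalingError (alternatingWeight p q) (alternatingCost fun i j => M i j / γ)
      (scalingSeq p q fun i j => M i j / γ) t = δ) {B πhat : Plan n}
    (hB : B = (scaledKernel (fun i j => Real.exp ((0 - M i j) / γ))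
      (sinkhornState p q (fun i j => M i j / γ) (t + 1))).val)
    (hπ : πhat = (sinkhornFinish (fun i j => Real.exp ((0 - M i j) / γ)) p q
      (sinkhornState p q (fun i j => M i j / γ) (t + 1))).val) :
    ∑ i, ∑ j, B i j = ∑ i, p i ∧ πhat ∈ polytope p q ∧ (∀ i j, 0 < πhat i j) ∧
    (∀ s, 0 < s → ∑ i, ∑ j, πhat i j * Real.log (πhat i j / B i j) ≤
      δ / 2 * (2 * R - Real.log s) + n * s) ∧
    ∀ y ∈ polytope p q, ∑ i, ∑ j, y i j * Real.log (B i j / πhat i j) ≤ δ / 2 := by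
  have hS := isScalingSeq hn hp hq hp0 hq0 hm
  have hpos := hS.coupling_pos t
  have hlow : ∀ i j, alternatingWeight p q (t + 1) i * alternatingWeight p q t j *
      Real.exp (-(2 * R)) ≤ scalingCoupling (alternatingWeight p q)
        (alternatingCost fun i j => M i j / γ) (scalingSeq p q fun i j => M i j / γ) t i j :=
    fun i j => mul_le_mul_of_nonneg_left (Real.exp_le_exp.2 (hS.neg_two_mul_le t i j))
      (mul_pos (hS.weight_pos _ _) (hS.weight_pos _ _)).le
  have hrow := hS.sum_coupling_row t
  have hmass := hS.sum_coupling t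
  rw [sinkhornFinish_val, ← hB] at hπ
  obtain ⟨k, rfl | rfl⟩ := Nat.even_or_odd' t
  · rw [scaledKernel_sinkhornState_odd hp0 hq0] at hB
    rw [← hB] at hpos hlow hrow hmass
    rw [scalingError, ← hB] at hδ
    simp only [alternatingWeight_odd, alternatingWeight_even] at hlow hrow hδ
    rw [roundPlan_of_rowSums hp0 hpos hrow] at hπ
    subst hπ
    exact ⟨hmass.trans hp.2.symm, roundCols_spec hp hq hq0 hpos hrow hlow hδ⟩
  · rw [scaledKernel_sinkhornState_even hp0 hq0] at hB
    set G := scalingCoupling (alternatingWeight p q) (alternatingCost fun i j => M i j / γ)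
      (scalingSeq p q fun i j => M i j / γ) (2 * k + 1) with hG
    have hBG : ∀ i j, B i j = G j i := fun i j => by rw [hB]
    rw [scalingError, ← hG] at hδ
    simp only [show 2 * k + 1 + 1 = 2 * (k + 1) by ring, alternatingWeight_odd,
      alternatingWeight_even] at hlow hrow hδ
    have hπ' : ∀ i j, πhat i j = roundCols q p G j i := fun i j => by
      rw [hπ, roundPlan_of_colSums hp0 (hp.2.trans hq.2.symm) (fun i j => hBG i j ▸ hpos j i)
        (fun j => by simp only [hBG]; exact hrow j)]
      simp only [hBG]
    obtain ⟨h1, h2, h3, h4⟩ := roundCols_spec hq hp hp0 hpos hrow hlow hδ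
    have hpoly : ∀ {a b : Fin n → ℝ} {y : Plan n}, y ∈ polytope a b →
        (fun i j => y j i) ∈ polytope b a := fun hy => ⟨fun i j => hy.1 j i, hy.2.2, hy.2.1⟩
    refine ⟨?_, ?_, fun i j => by rw [hπ']; exact h2 j i, fun s hs => ?_, fun y hy => ?_⟩
    · simp only [hBG]; rw [Finset.sum_comm, hmass, hp.2]
    · convert hpoly h1 using 1
      funext i j
      exact hπ' i j
    · simp only [hπ', hBG]; rw [Finset.sum_comm]; exact h3 s hs
    · simp only [hπ', hBG]; rw [Finset.sum_comm]; exact h4 _ (hpoly hy)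

end Iterates

/-! ### Extremal entries -/

lemma le_maxEntry (M : Plan n) (i j : Fin n) : M i j ≤ maxEntry M :=
  (le_ciSup (Set.finite_range _).bddAbove j).trans
    (le_ciSup (f := fun i => ⨆ j, M i j) (Set.finite_range _).bddAbove i)

lemma minEntry_le (M : Plan n) (i j : Fin n) : minEntry M ≤ M i j :=
  (ciInf_le (f := fun i => ⨅ j, M i j) (Set.finite_range _).bddBelow i).trans
    (ciInf_le (Set.finite_range _).bddBelow j)

lemma maxEntry_le (hn : 0 < n) {M : Plan n} {b : ℝ} (h : ∀ i j, M i j ≤ b) : maxEntry M ≤ b := by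
  have : Nonempty (Fin n) := ⟨⟨0, hn⟩⟩
  exact ciSup_le fun i => ciSup_le fun j => h i j

lemma le_minEntry (hn : 0 < n) {M : Plan n} {b : ℝ} (h : ∀ i j, b ≤ M i j) : b ≤ minEntry M := by
  have : Nonempty (Fin n) := ⟨⟨0, hn⟩⟩
  exact le_ciInf fun i => le_ciInf fun j => h i j

lemma minEntry_pos (hn : 0 < n) {M : Plan n} (h : ∀ i j, 0 < M i j) : 0 < minEntry M := by
  have : Nonempty (Fin n) := ⟨⟨0, hn⟩⟩
  obtain ⟨⟨i, j⟩, hij⟩ := Finite.exists_min fun x : Fin n × Fin n => M x.1 x.2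
  exact (h i j).trans_le (le_minEntry hn fun i' j' => hij (i', j'))

lemma entry_div_sub_le {M : Plan n} {γ R : ℝ} (hγ : 0 < γ) (hR : maxEntry M - minEntry M ≤ R)
    (i j i' j' : Fin n) : M i j / γ - M i' j' / γ ≤ R / γ := by
  rw [← sub_div]
  exact div_le_div_of_nonneg_right (by linarith [le_maxEntry M i j, minEntry_le M i' j']) hγ.le

/-- Nonnegativity of `C` confines its entries to an interval of length `‖C‖`. -/
lemma range_proxCost_le (hn : 0 < n) {C ρ : Plan n} {L : ℝ} (hL : 0 < L) (hC : ∀ i j, 0 ≤ C i j)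
    (hρ : ∀ i j, 0 < ρ i j) :
    maxEntry (proxCost C L ρ).val - minEntry (proxCost C L ρ).val ≤ cBar C L ρ := by
  have hmin := minEntry_pos hn hρ
  have hmax : 0 < maxEntry ρ := (hρ ⟨0, hn⟩ ⟨0, hn⟩).trans_le (le_maxEntry ρ _ _)
  have h1 : maxEntry (proxCost C L ρ).val ≤ ‖C‖ - L * Real.log (minEntry ρ) :=
    maxEntry_le hn fun i j => by
      have h2 : C i j ≤ ‖C‖ :=
        (le_abs_self _).trans ((norm_le_pi_norm (C i) j).trans (norm_le_pi_norm C i))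
      have h3 := mul_le_mul_of_nonneg_left (Real.log_le_log hmin (minEntry_le ρ i j)) hL.le
      rw [proxCost_val]
      linarith
  have h2 : -(L * Real.log (maxEntry ρ)) ≤ minEntry (proxCost C L ρ).val :=
    le_minEntry hn fun i j => by
      have h3 := mul_le_mul_of_nonneg_left (Real.log_le_log (hρ i j) (le_maxEntry ρ i j)) hL.le
      have := hC i j
      rw [proxCost_val]
      linarith
  rw [cBar, Real.log_div hmax.ne' hmin.ne']
  linarith

end ProxSinkhorn
namespace ProxSinkhorn

/-! ### Iteration counts -/

/-- Uses `1 - exp (-R) ≤ exp (-exp (-R))`. -/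
lemma exists_mul_pow_le_one (R Y : ℝ) (hR : 0 ≤ R) :
    ∃ s : ℕ, (s : ℝ) ≤ Real.exp R * max 0 (Real.log Y) + 1 ∧ Y * (1 - Real.exp (-R)) ^ s ≤ 1 := by
  set l := max 0 (Real.log Y) with hl
  have hl0 : 0 ≤ l := le_max_left _ _
  have hκ : 0 ≤ 1 - Real.exp (-R) := by
    have : Real.exp (-R) ≤ 1 := Real.exp_le_one_iff.2 (by linarith)
    linarith
  refine ⟨⌈Real.exp R * l⌉₊, (Nat.ceil_lt_add_one (by positivity)).le, ?_⟩
  set s := ⌈Real.exp R * l⌉₊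
  rcases le_or_gt Y 0 with hY | hY
  · exact (mul_nonpos_of_nonpos_of_nonneg hY (pow_nonneg hκ s)).trans zero_le_one
  have hYl : Y ≤ Real.exp l := by
    rw [← Real.log_le_iff_le_exp hY]; exact le_max_right _ _
  have hpow : (1 - Real.exp (-R)) ^ s ≤ Real.exp (-l) := by
    calc (1 - Real.exp (-R)) ^ s ≤ Real.exp (-Real.exp (-R)) ^ s :=
          pow_le_pow_left₀ hκ (by linarith [Real.add_one_le_exp (-Real.exp (-R))]) s
      _ = Real.exp (s * -Real.exp (-R)) := (Real.exp_nat_mul _ _).symm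
      _ ≤ Real.exp (-l) := by
          refine Real.exp_le_exp.2 ?_
          have h1 : Real.exp R * l ≤ s := Nat.le_ceil _
          have h2 := mul_le_mul_of_nonneg_right h1 (Real.exp_pos (-R)).le
          have h3 : Real.exp R * l * Real.exp (-R) = l := by
            rw [mul_right_comm, ← Real.exp_add]; simp
          linarith
  calc Y * (1 - Real.exp (-R)) ^ s ≤ Real.exp l * Real.exp (-l) :=
        mul_le_mul hYl hpow (pow_nonneg hκ s) (Real.exp_pos _).le
    _ = 1 := by rw [← Real.exp_add]; simp

lemma log_le_self_of_nonneg {x : ℝ} (hx : 0 ≤ x) : Real.log x ≤ x := by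
  rcases hx.eq_or_lt with h | h
  · rw [← h]; simp
  · linarith [Real.log_le_sub_one_of_pos h]

section Rate

variable {n : ℕ} {R w δ : ℝ} {T : ℕ}

lemma log_four_mul_sq_le (hn : 2 ≤ n) : Real.log (4 * (n : ℝ) ^ 2) ≤ 4 * Real.log n := by
  have hn2 : (2 : ℝ) ≤ n := by exact_mod_cast hn
  rw [← Real.log_rpow (by linarith)]
  refine Real.log_le_log (by positivity) ?_
  norm_cast
  have h : 2 ^ 2 ≤ n ^ 2 := Nat.pow_le_pow_left hn 2
  calc 4 * n ^ 2 ≤ n ^ 2 * n ^ 2 := Nat.mul_le_mul_right _ h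
    _ = n ^ 4 := by ring

lemma half_le_log (hn : 2 ≤ n) : 1 / 2 ≤ Real.log n := by
  have hn2 : (2 : ℝ) ≤ n := by exact_mod_cast hn
  have := Real.log_le_log (by norm_num) hn2
  have := Real.log_two_gt_d9
  linarith

/-- The logarithm must contain `R² w` rather than `R w`, to stay below `R² w` for small `R`. Two
extra contractions by `κ ≤ R` achieve this: one supplies the missing factor `R`, the other tames `ln
w = ln (R² w) - 2 ln R`, because `-R ln R ≤ 1`. -/
lemma iterations_le_of_osc_le_one (hn : 2 ≤ n) (hR : 0 ≤ R) (hR1 : R ≤ 1) (hw : 0 < w)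
    (hX : 1 < 4 * (n : ℝ) ^ 2 * w) (hδ : 0 < δ)
    (hδw : δ⁻¹ ≤ 4 * w * (R + 2 * Real.log (4 * (n : ℝ) ^ 2 * w)))
    (hT : ∀ t : ℕ, 2 * ((1 - Real.exp (-R)) ^ t * R) ≤ δ → T ≤ t + 1) :
    (T : ℝ) ≤ 80 * Real.log n * (1 + max 0 (Real.log (R ^ 2 * w))) := by
  have hn0 : (0 : ℝ) < n := by exact_mod_cast (by omega : 0 < n)
  set κ := 1 - Real.exp (-R) with hκ
  have hκ0 : 0 ≤ κ := by
    have : Real.exp (-R) ≤ 1 := Real.exp_le_one_iff.2 (by linarith)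
    linarith
  have hκR : κ ≤ R := by linarith [Real.add_one_le_exp (-R)]
  have hκ1 : κ ≤ 1 := hκR.trans hR1
  set l4 := Real.log (4 * (n : ℝ) ^ 2) with hl4
  have hl40 : 0 ≤ l4 := Real.log_nonneg (by
    have : (2 : ℝ) ≤ n := by exact_mod_cast hn
    nlinarith)
  have hl4n : l4 ≤ 4 * Real.log n := log_four_mul_sq_le hn
  have hln := half_le_log hn
  have hℓ : Real.log (4 * (n : ℝ) ^ 2 * w) = l4 + Real.log w :=
    Real.log_mul (by positivity) hw.ne'
  have hℓ0 : 0 < Real.log (4 * (n : ℝ) ^ 2 * w) := Real.log_pos hX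
  set lz := max 0 (Real.log (R ^ 2 * w)) with hlz
  have hlz0 : 0 ≤ lz := le_max_left _ _
  set U := 5 + 2 * l4 + 2 * lz with hU
  have hU0 : 0 < U := by positivity
  have hY : 2 * κ ^ 2 * R * δ⁻¹ ≤ 8 * (R ^ 2 * w) * U := by
    rcases hR.eq_or_lt with h0 | h0
    · rw [← h0]; simp
    have h1 : κ * (R + 2 * Real.log (4 * (n : ℝ) ^ 2 * w)) ≤ U := by
      have h2 : Real.log w = Real.log (R ^ 2 * w) - 2 * Real.log R := by
        rw [Real.log_mul (by positivity) hw.ne', Real.log_pow]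
        push_cast
        ring
      have h3 : κ * Real.log (R ^ 2 * w) ≤ lz :=
        (mul_le_mul_of_nonneg_left (le_max_right 0 _) hκ0).trans (mul_le_of_le_one_left hlz0 hκ1)
      have h4 : κ * -Real.log R ≤ 1 := by
        have h5 : 0 ≤ -Real.log R := neg_nonneg.2 (Real.log_nonpos hR hR1)
        have h6 := sub_le_mul_log_div one_pos h0
        rw [div_one] at h6
        have := mul_le_mul_of_nonneg_right hκR h5
        linarith
      have h7 : κ * R ≤ 1 := mul_le_one₀ hκ1 hR hR1
      have h8 : κ * l4 ≤ l4 := mul_le_of_le_one_left hl40 hκ1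
      rw [hℓ, h2]
      linarith
    calc 2 * κ ^ 2 * R * δ⁻¹
        ≤ 2 * κ ^ 2 * R * (4 * w * (R + 2 * Real.log (4 * (n : ℝ) ^ 2 * w))) :=
          mul_le_mul_of_nonneg_left hδw (by positivity)
      _ = 8 * (κ * R * w) * (κ * (R + 2 * Real.log (4 * (n : ℝ) ^ 2 * w))) := by ring
      _ ≤ 8 * (R ^ 2 * w) * U := by
          have h9 : κ * R * w ≤ R ^ 2 * w := by
            rw [pow_two]
            exact mul_le_mul_of_nonneg_right (mul_le_mul_of_nonneg_right hκR hR) hw.le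
          exact mul_le_mul (by linarith) h1 (mul_nonneg hκ0 (by linarith)) (by positivity)
  obtain ⟨s, hs, hs1⟩ := exists_mul_pow_le_one R (8 * (R ^ 2 * w) * U) hR
  have hTs : T ≤ s + 2 + 1 := hT (s + 2) (by
    have h1 := (mul_le_mul_of_nonneg_right hY (pow_nonneg hκ0 s)).trans hs1
    have h2 := mul_le_mul_of_nonneg_right h1 hδ.le
    have h3 : 2 * κ ^ 2 * R * δ⁻¹ * κ ^ s * δ = 2 * (κ ^ (s + 2) * R) := by
      field_simp
      ring
    linarith)
  have hTs' : (T : ℝ) ≤ s + 3 := by exact_mod_cast hTs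
  have hlY : max 0 (Real.log (8 * (R ^ 2 * w) * U)) ≤ 3 + lz + U := by
    refine max_le (by positivity) ?_
    rcases hR.eq_or_lt with h0 | h0
    · rw [← h0]; simp; positivity
    have h8 : Real.log 8 ≤ 3 := by
      rw [show (8 : ℝ) = 2 ^ 3 by norm_num, Real.log_pow]
      have := Real.log_two_lt_d9
      push_cast
      linarith
    rw [Real.log_mul (by positivity) hU0.ne', Real.log_mul (by norm_num) (by positivity)]
    linarith [log_le_self_of_nonneg hU0.le, le_max_right 0 (Real.log (R ^ 2 * w))]
  have hexp : Real.exp R ≤ 3 := by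
    have := Real.exp_le_exp.2 hR1
    have := Real.exp_one_lt_d9
    linarith
  have hfin : Real.exp R * max 0 (Real.log (8 * (R ^ 2 * w) * U)) ≤ 3 * (3 + lz + U) :=
    mul_le_mul hexp hlY (le_max_left _ _) (by norm_num)
  have h10 : 9 * lz ≤ 80 * Real.log n * lz := mul_le_mul_of_nonneg_right (by linarith) hlz0
  linarith

lemma iterations_le_of_one_le_osc (hn : 2 ≤ n) (hR1 : 1 ≤ R) (hw : 0 < w)
    (hX : 1 < 4 * (n : ℝ) ^ 2 * w) (hδ : 0 < δ)
    (hδw : δ⁻¹ ≤ 4 * w * (R + 2 * Real.log (4 * (n : ℝ) ^ 2 * w)))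
    (hT : ∀ t : ℕ, 2 * ((1 - Real.exp (-R)) ^ t * R) ≤ δ → T ≤ t + 1) :
    (T : ℝ) ≤ 2 + 20 * Real.log n * (Real.exp R * (R + max 0 (Real.log (R * w)))) := by
  have hn0 : (0 : ℝ) < n := by exact_mod_cast (by omega : 0 < n)
  have hR : 0 < R := by linarith
  have hl4n := log_four_mul_sq_le hn
  have hln := half_le_log hn
  have hℓ : Real.log (4 * (n : ℝ) ^ 2 * w) = Real.log (4 * (n : ℝ) ^ 2) + Real.log w :=
    Real.log_mul (by positivity) hw.ne'
  have hℓ0 : 0 < Real.log (4 * (n : ℝ) ^ 2 * w) := Real.log_pos hX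
  set ℓ := Real.log (4 * (n : ℝ) ^ 2 * w) with hℓdef
  set l := max 0 (Real.log (R * w)) with hl
  have hl0 : 0 ≤ l := le_max_left _ _
  have hlw : Real.log w ≤ l :=
    (Real.log_le_log hw (le_mul_of_one_le_left hw.le hR1)).trans (le_max_right _ _)
  obtain ⟨s, hs, hs1⟩ := exists_mul_pow_le_one R (8 * (R * w) * (R + 2 * ℓ)) hR.le
  have hκ0 : 0 ≤ 1 - Real.exp (-R) := by
    have : Real.exp (-R) ≤ 1 := Real.exp_le_one_iff.2 (by linarith)
    linarith
  have hTs : T ≤ s + 1 := hT s (by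
    have h0 : 2 * R * δ⁻¹ ≤ 8 * (R * w) * (R + 2 * ℓ) := by
      have := mul_le_mul_of_nonneg_left hδw (by positivity : 0 ≤ 2 * R)
      linarith
    have h1 := (mul_le_mul_of_nonneg_right h0 (pow_nonneg hκ0 s)).trans hs1
    have h2 := mul_le_mul_of_nonneg_right h1 hδ.le
    have h3 : 2 * R * δ⁻¹ * (1 - Real.exp (-R)) ^ s * δ = 2 * ((1 - Real.exp (-R)) ^ s * R) := by
      field_simp
    linarith)
  have hTs' : (T : ℝ) ≤ s + 1 := by exact_mod_cast hTs
  have hlY : max 0 (Real.log (8 * (R * w) * (R + 2 * ℓ))) ≤ 20 * Real.log n * (R + l) := by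
    refine max_le (by positivity) ?_
    have h8 : Real.log 8 ≤ 3 := by
      rw [show (8 : ℝ) = 2 ^ 3 by norm_num, Real.log_pow]
      have := Real.log_two_lt_d9
      push_cast
      linarith
    rw [Real.log_mul (by positivity) (by positivity), Real.log_mul (by norm_num) (by positivity)]
    have h9 := log_le_self_of_nonneg (x := R + 2 * ℓ) (by positivity)
    have h10 : Real.log (R * w) ≤ l := le_max_right _ _
    have h11 : (3 + 8 * Real.log n) * 1 ≤ (3 + 8 * Real.log n) * (R + l) :=
      mul_le_mul_of_nonneg_left (by linarith) (by linarith)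
    have h12 : 6 * (R + l) ≤ (12 * Real.log n) * (R + l) :=
      mul_le_mul_of_nonneg_right (by linarith) (by linarith)
    linarith
  have := mul_le_mul_of_nonneg_left hlY (Real.exp_pos R).le
  linarith

/-- The number of iterations, bounded by combining the linear and the sublinear rate. -/
lemma iterations_le (hn : 2 ≤ n) (hR : 0 ≤ R) (hw : 0 < w)
    (hX : 1 < 4 * (n : ℝ) ^ 2 * w) (hδ : 0 < δ)
    (hδw : δ⁻¹ ≤ 4 * w * (R + 2 * Real.log (4 * (n : ℝ) ^ 2 * w)))
    (hT : ∀ t : ℕ, 2 * ((1 - Real.exp (-R)) ^ t * R) ≤ δ → T ≤ t + 1)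
    (hT' : 0 < R → (T : ℝ) ≤ 36 * R / δ + 1) :
    (T : ℝ) ≤ 4000 * Real.log n *
      (1 + min (Real.exp R * (R + max 0 (Real.log (R * w)))) (R ^ 2 * w)) := by
  have hln := half_le_log hn
  have hn0 : (0 : ℝ) < n := by exact_mod_cast (by omega : 0 < n)
  rw [← min_add_add_left, mul_min_of_nonneg _ _ (by linarith), le_min_iff]
  set l := max 0 (Real.log (R * w)) with hl
  have hl0 : 0 ≤ l := le_max_left _ _
  have hA0 : 0 ≤ Real.exp R * (R + l) := by positivity
  have hB0 : 0 ≤ R ^ 2 * w := by positivity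
  rcases le_total R 1 with hR1 | hR1
  · have h := iterations_le_of_osc_le_one hn hR hR1 hw hX hδ hδw hT
    have hz : max 0 (Real.log (R ^ 2 * w)) ≤ R ^ 2 * w :=
      max_le hB0 (log_le_self_of_nonneg hB0)
    have hz' : max 0 (Real.log (R ^ 2 * w)) ≤ Real.exp R * (R + l) := by
      have h1 : max 0 (Real.log (R ^ 2 * w)) ≤ l := by
        rcases hR.eq_or_lt with h0 | h0
        · rw [hl, ← h0]; simp
        · refine max_le_max le_rfl (Real.log_le_log (by positivity) ?_)
          exact mul_le_mul_of_nonneg_right (by nlinarith) hw.le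
      have h2 : 1 * (R + l) ≤ Real.exp R * (R + l) :=
        mul_le_mul_of_nonneg_right (Real.one_le_exp hR) (by positivity)
      linarith
    constructor
    · refine h.trans (mul_le_mul (by linarith) (by linarith) ?_ (by linarith))
      linarith [le_max_left 0 (Real.log (R ^ 2 * w))]
    · refine h.trans (mul_le_mul (by linarith) (by linarith) ?_ (by linarith))
      linarith [le_max_left 0 (Real.log (R ^ 2 * w))]
  · have hR0 : 0 < R := by linarith
    have h := iterations_le_of_one_le_osc hn hR1 hw hX hδ hδw hT
    rw [← hl] at h
    have hlnA : 0 ≤ Real.log n * (Real.exp R * (R + l)) := mul_nonneg (by linarith) hA0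
    have hlnB : 0 ≤ Real.log n * (R ^ 2 * w) := mul_nonneg (by linarith) hB0
    refine ⟨by linarith, ?_⟩
    -- If `ln w ≤ 4R`, the logarithm in the threshold is absorbed by `R` and `ln n`, and the
    -- sublinear rate suffices.
    rcases le_or_gt (Real.log w) (4 * R) with hwR | hwR
    · have h1 := hT' hR0
      have h2 : 36 * R / δ ≤ 36 * R * (4 * w * (26 * R * Real.log n)) := by
        rw [div_eq_mul_inv]
        refine mul_le_mul_of_nonneg_left (hδw.trans ?_) (by positivity)
        refine mul_le_mul_of_nonneg_left ?_ (by positivity)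
        rw [Real.log_mul (by positivity) hw.ne']
        have h3 := log_four_mul_sq_le hn
        have h4 : 9 * R ≤ 18 * R * Real.log n := by nlinarith
        have h5 : 8 * Real.log n ≤ 8 * R * Real.log n := by nlinarith
        linarith
      have h6 : 36 * R * (4 * w * (26 * R * Real.log n)) = 3744 * (Real.log n * (R ^ 2 * w)) := by
        ring
      linarith
    -- Otherwise `exp R ≤ w^(1/4)` and `R + l ≤ 2 w^(3/4)`, so the linear-rate bound is already of
    -- order `w ≤ R² w`.
    · set ω := Real.log w with hω
      have hwexp : w = Real.exp ω := (Real.exp_log hw).symm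
      have hV : R + l ≤ 2 * Real.exp (3 * ω / 4) := by
        have h1 : l ≤ R + ω := by
          refine max_le (by linarith) ?_
          rw [Real.log_mul hR0.ne' hw.ne']
          linarith [log_le_self_of_nonneg hR]
        linarith [Real.add_one_le_exp (3 * ω / 4)]
      have hE : Real.exp R * (R + l) ≤ 2 * w := by
        have h1 : Real.exp R ≤ Real.exp (ω / 4) := Real.exp_le_exp.2 (by linarith)
        have h2 := mul_le_mul h1 hV (by positivity) (Real.exp_pos _).le
        have h3 : Real.exp (ω / 4) * (2 * Real.exp (3 * ω / 4)) = 2 * w := by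
          rw [mul_left_comm, ← Real.exp_add, hwexp]
          congr 2
          ring
        linarith
      have hw2 : w ≤ R ^ 2 * w := le_mul_of_one_le_left hw.le (by nlinarith)
      have h4 : Real.log n * (Real.exp R * (R + l)) ≤ Real.log n * (2 * (R ^ 2 * w)) :=
        mul_le_mul_of_nonneg_left (by linarith) (by linarith)
      linarith

end Rate

end ProxSinkhorn
namespace ProxSinkhorn

/-! ### Inner solves -/

variable {n : ℕ} {p q : Fin n → ℝ} {C ρ : Plan n} {L εt : ℝ}

/-- The stopping threshold of an inner solve. -/
noncomputable def innerThreshold (C : Plan n) (L εt : ℝ) (ρ : Plan n) : ℝ :=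
  εt / 4 / (maxEntry (proxCost C L ρ).val - minEntry (proxCost C L ρ).val +
    2 * L * Real.log (4 * L * ((n : ℝ) * (n : ℝ)) / εt))

lemma range_nonneg (hn : 0 < n) (M : Plan n) : 0 ≤ maxEntry M - minEntry M := by
  linarith [le_maxEntry M ⟨0, hn⟩ ⟨0, hn⟩, minEntry_le M ⟨0, hn⟩ ⟨0, hn⟩]

lemma innerSolve_iff {πhat : Plan n} {T k : ℕ} :
    InnerSolve C L εt p q ρ πhat T k ↔ ∃ (s : Potentials n) (kLoop : ℕ),
    RepeatUntil
      (sinkhornStep (fun i j => Real.exp ((0 - (proxCost C L ρ).val i j) / L)) p q)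
      (sinkhornTest (fun i j => Real.exp ((0 - (proxCost C L ρ).val i j) / L)) p q
        (innerThreshold C L εt ρ))
      0 (sinkhornState p q (fun i j => (proxCost C L ρ).val i j / L) 0) T s kLoop ∧
    πhat = (sinkhornFinish (fun i j => Real.exp ((0 - (proxCost C L ρ).val i j) / L)) p q s).val ∧
    k = 3 * n ^ 2 + ((sinkhornSetup (proxCost C L ρ).val L εt p q).ops + kLoop +
      (11 * n ^ 2 + 10 * n)) := by
  -- At time `0` natural subtraction turns the index `2 * 0 - 1` into `0`, where the potential
  -- vanishes.
  have h0 : sinkhornState p q (fun i j => (proxCost C L ρ).val i j / L) 0 =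
      (fun i => Real.log (p i), fun j => Real.log (q j)) := by
    simp [sinkhornState, scalingSeq]
  simp only [InnerSolve, SinkhornRun, sinkhornSetup_kernel, sinkhornSetup_threshold,
    sinkhornSetup_potentials, sinkhornFinish_ops, proxCost_ops, h0, innerThreshold]
  constructor
  · rintro ⟨k', ⟨s, kl, h1, h2, rfl⟩, rfl⟩
    exact ⟨s, kl, h1, h2, rfl⟩
  · rintro ⟨s, kl, h1, h2, rfl⟩
    exact ⟨_, ⟨s, kl, h1, h2, rfl⟩, rfl⟩

/-- The rounding bound is applied with `s = X⁻¹`, `X = 4 L n² / εt`, so that its logarithm is the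
one in the stopping threshold. The condition `ln X ≥ 1` absorbs the extra `L δ / 2` in the
precision, which is thus reached directly and not through the residual. -/
lemma innerSolve_accuracy (hn : 2 ≤ n) (hp : p ∈ stdSimplex ℝ (Fin n))
    (hq : q ∈ stdSimplex ℝ (Fin n)) (hp0 : ∀ i, 0 < p i) (hq0 : ∀ j, 0 < q j) (hL : 0 < L)
    (hεt : 0 < εt) (hX : 1 ≤ Real.log (4 * L * ((n : ℝ) * (n : ℝ)) / εt))
    (hρ : ∀ i j, 0 < ρ i j) {πhat : Plan n} {T k : ℕ} (h : InnerSolve C L εt p q ρ πhat T k) :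
    (∀ i j, 0 < πhat i j) ∧ IsResidualMin (polytope p q) (proxObjective C L ρ) εt πhat ∧
      IsInexactMin (polytope p q) (proxObjective C L ρ) εt πhat := by
  have hn0 : 0 < n := by omega
  have hn2 : (2 : ℝ) ≤ n := by exact_mod_cast hn
  obtain ⟨s, kl, hrun, hπ, -⟩ := innerSolve_iff.1 h
  set M := (proxCost C L ρ).val with hM
  obtain ⟨t, rfl, rfl, htest⟩ := repeatUntil_sound
    (sinkhornStep_sinkhornState hn0 hp0 hq0) hrun rfl
  set D := maxEntry M - minEntry M with hD
  have hD0 : 0 ≤ D := range_nonneg hn0 M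
  have hosc : ∀ i j i' j', M i j / L - M i' j' / L ≤ D / L := entry_div_sub_le hL le_rfl
  rw [sinkhornTest_sinkhornState_succ hn0 hp hq hp0 hq0 hosc] at htest
  set δ := scalingError (alternatingWeight p q) (alternatingCost fun i j => M i j / L)
    (scalingSeq p q fun i j => M i j / L) t with hδ
  have hδ0 : 0 ≤ δ := IsScalingSeq.error_nonneg _ _ _ _
  set X := 4 * L * ((n : ℝ) * (n : ℝ)) / εt with hXdef
  have hX0 : 0 < X := by positivity
  have hthr : δ * (D + 2 * L * Real.log X) ≤ εt / 4 := by
    rwa [innerThreshold, le_div_iff₀ (by positivity)] at htest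
  obtain ⟨hmass, hmem, hpos, hkl, hlog⟩ :=
    sinkhornFinish_spec hn0 hp hq hp0 hq0 hosc t hδ.symm rfl hπ
  have hB : ∀ i j, (scaledKernel (fun i j => Real.exp ((0 - M i j) / L))
      (sinkhornState p q (fun i j => M i j / L) (t + 1))).val i j =
      Real.exp ((sinkhornState p q (fun i j => M i j / L) (t + 1)).1 i +
        (sinkhornState p q (fun i j => M i j / L) (t + 1)).2 j -
          (C i j - L * Real.log (ρ i j)) / L) := fun i j => by
    simp only [scaledKernel_val, exp_mul_exp_mul_exp, hM, proxCost_val]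
  have hsol := isResidualMin_and_isInexactMin_of_scaled hL hρ hB hmass hmem hpos
    (hkl X⁻¹ (inv_pos.2 hX0)) hlog
  have hLδ0 : 0 ≤ L * δ := by positivity
  have hLδ : L * δ ≤ L * δ * Real.log X := le_mul_of_one_le_right (by positivity) hX
  have hXinv : L * (n * X⁻¹) ≤ εt / 8 := by
    have : L * (n * X⁻¹) = εt / (4 * n) := by
      rw [hXdef]; field_simp
    rw [this]
    exact div_le_div_of_nonneg_left hεt.le (by norm_num) (by linarith)
  have hres : L * (δ / 2 * (2 * (D / L) - Real.log X⁻¹) + n * X⁻¹) =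
      δ * D + L * δ * Real.log X / 2 + L * (n * X⁻¹) := by
    rw [Real.log_inv]
    field_simp
    ring
  have hδD := mul_nonneg hδ0 hD0
  refine ⟨hpos, ⟨hmem, fun y hy => (hsol.1.2 y hy).trans ?_⟩, hmem, hsol.2.2.1,
    fun y hy => (hsol.2.2.2 y hy).trans ?_⟩
  · linarith
  · rw [mul_add, hres]
    linarith

lemma innerThreshold_inv_le (hn : 0 < n) (hC : ∀ i j, 0 ≤ C i j) (hL : 0 < L) (hεt : 0 < εt)
    (hX : 0 < Real.log (4 * L * ((n : ℝ) * (n : ℝ)) / εt)) (hρ : ∀ i j, 0 < ρ i j) :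
    0 < innerThreshold C L εt ρ ∧ (innerThreshold C L εt ρ)⁻¹ ≤
      4 * (L / εt) * (cBar C L ρ / L + 2 * Real.log (4 * (n : ℝ) ^ 2 * (L / εt))) := by
  have hrange := range_proxCost_le hn hL hC hρ
  have hD0 := range_nonneg hn (proxCost C L ρ).val
  have harg : 4 * (n : ℝ) ^ 2 * (L / εt) = 4 * L * ((n : ℝ) * (n : ℝ)) / εt := by ring
  rw [harg, innerThreshold]
  set X := Real.log (4 * L * ((n : ℝ) * (n : ℝ)) / εt)
  refine ⟨by positivity, ?_⟩
  rw [inv_div]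
  have h1 : 4 * (L / εt) * (cBar C L ρ / L + 2 * X) = (cBar C L ρ + 2 * L * X) / (εt / 4) := by
    field_simp
  rw [h1]
  exact div_le_div_of_nonneg_right (by linarith) (by positivity)

lemma innerRate_eq (hL : 0 < L) (hεt : 0 < εt) (c : ℝ) :
    innerRate c L εt = 1 + min (Real.exp (c / L) * (c / L + max 0 (Real.log (c / L * (L / εt)))))
      ((c / L) ^ 2 * (L / εt)) := by
  have h1 : c / L * (L / εt) = c / εt := by field_simp
  have h2 : (c / L) ^ 2 * (L / εt) = c ^ 2 / (L * εt) := by field_simp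
  rw [innerRate, h1, h2]

lemma exists_innerSolve (hn : 2 ≤ n) (hC : ∀ i j, 0 ≤ C i j) (hp : p ∈ stdSimplex ℝ (Fin n))
    (hq : q ∈ stdSimplex ℝ (Fin n)) (hp0 : ∀ i, 0 < p i) (hq0 : ∀ j, 0 < q j) (hL : 0 < L)
    (hεt : 0 < εt) (hεtL : εt < 4 * L * (n : ℝ) ^ 2) (hρ : ∀ i j, 0 < ρ i j) :
    ∃ πhat T k, InnerSolve C L εt p q ρ πhat T k ∧
      (T : ℝ) ≤ 4000 * Real.log n * innerRate (cBar C L ρ) L εt ∧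
      (k : ℝ) ≤ (n : ℝ) ^ 2 * (54 * (4000 * Real.log n * innerRate (cBar C L ρ) L εt)) := by
  have hn0 : 0 < n := by omega
  have hX : 1 < 4 * (n : ℝ) ^ 2 * (L / εt) := by
    rw [← mul_div_assoc, one_lt_div hεt]; linarith
  have harg : 4 * (n : ℝ) ^ 2 * (L / εt) = 4 * L * ((n : ℝ) * (n : ℝ)) / εt := by ring
  obtain ⟨hδ, hδw⟩ := innerThreshold_inv_le hn0 hC hL hεt (harg ▸ Real.log_pos hX) hρ
  set δ := innerThreshold C L εt ρ with hδdef
  set M := (proxCost C L ρ).val with hM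
  set R := cBar C L ρ / L with hR
  have hosc : ∀ i j i' j', M i j / L - M i' j' / L ≤ R :=
    entry_div_sub_le hL (range_proxCost_le hn0 hL hC hρ)
  have hS := isScalingSeq hn0 hp hq hp0 hq0 (m := fun i j => M i j / L) hosc
  have hR0 : 0 ≤ R := hS.osc_nonneg
  set err := scalingError (alternatingWeight p q) (alternatingCost fun i j => M i j / L)
    (scalingSeq p q fun i j => M i j / L) with herr
  have hex : ∃ t, err t ≤ δ := by
    -- The shift to `R + 1` covers `R = 0`; only termination is needed here.
    obtain ⟨t, -, ht⟩ := hS.exists_error_le (R' := R + 1) (by linarith) (by linarith) hδ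
    exact ⟨t, ht⟩
  classical
  have htest_find := (sinkhornTest_sinkhornState_succ hn0 hp hq hp0 hq0 hosc δ _).2 (Nat.find_spec hex)
  have hK : ∀ t s, (sinkhornStep (fun i j => Real.exp ((0 - M i j) / L)) p q t s).ops +
      (sinkhornTest (fun i j => Real.exp ((0 - M i j) / L)) p q δ
        (sinkhornStep (fun i j => Real.exp ((0 - M i j) / L)) p q t s).val).ops ≤ 15 * n ^ 2 := by
    intro t s
    rw [sinkhornStep_ops, sinkhornTest_ops]
    nlinarith
  obtain ⟨T, s, kl, hrun, hTm, hkl⟩ := repeatUntil_exists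
    (sinkhornStep_sinkhornState hn0 hp0 hq0) hK (Nat.find hex) 0 (by rwa [zero_add])
  have hTle : ∀ t, err t ≤ δ → T ≤ t + 1 := fun t ht => by
    have := Nat.find_min' hex ht
    omega
  have hTbound : (T : ℝ) ≤ 4000 * Real.log n * innerRate (cBar C L ρ) L εt := by
    rw [innerRate_eq hL hεt]
    refine iterations_le hn hR0 (by positivity) hX hδ hδw
      (fun t ht => hTle t ((hS.error_le t).trans ht)) fun hRpos => ?_
    obtain ⟨t, ht, hte⟩ := hS.exists_error_le hRpos le_rfl hδ
    have h1 : (T : ℝ) ≤ t + 1 := by exact_mod_cast hTle t hte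
    linarith
  refine ⟨_, T, _, innerSolve_iff.2 ⟨s, kl, hrun, rfl, rfl⟩, hTbound, ?_⟩
  have hsetup := sinkhornSetup_ops_le hn M L εt p q
  -- Setup, cost matrix and rounding contribute `39 n²`, each iteration at most `15 n²`. Since the
  -- iteration bound is at least one, `39 + 15` times it suffices.
  have hk : 3 * n ^ 2 + ((sinkhornSetup M L εt p q).ops + kl + (11 * n ^ 2 + 10 * n)) ≤
      n ^ 2 * (39 + 15 * T) := by
    nlinarith
  have hk' : ((3 * n ^ 2 + ((sinkhornSetup M L εt p q).ops + kl +
      (11 * n ^ 2 + 10 * n)) : ℕ) : ℝ) ≤ (n : ℝ) ^ 2 * (39 + 15 * T) := by exact_mod_cast hk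
  refine hk'.trans (mul_le_mul_of_nonneg_left ?_ (by positivity))
  have hrate : 1 ≤ innerRate (cBar C L ρ) L εt := by
    rw [innerRate_eq hL hεt]
    exact le_add_of_nonneg_right (le_min (by positivity) (by positivity))
  have hone : 1 ≤ 4000 * Real.log n * innerRate (cBar C L ρ) L εt :=
    one_le_mul_of_one_le_of_one_le (by linarith [half_le_log hn]) hrate
  linarith

/-- The hypothesis `ε³ ≤ L n⁴` makes `εt` at most `ε / 1000`; with `ε ≤ 4 L ln n` it is then far
below `4 L n²`. -/
lemma accuracy_bounds (hn : 2 ≤ n) {ε : ℝ} (hL : 0 < L) (hε : 0 < ε)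
    (hεL : ε ≤ 4 * L * Real.log n) (hε3 : ε ^ 3 ≤ L * (n : ℝ) ^ 4) (hεt0 : 0 < εt)
    (hεt : εt ≤ 1 / 1000 * (ε ^ 4 / (L * (n : ℝ) ^ 4))) :
    εt ≤ ε / 2 ∧ εt < 4 * L * (n : ℝ) ^ 2 ∧
      1 ≤ Real.log (4 * L * ((n : ℝ) * (n : ℝ)) / εt) := by
  have hn2 : (2 : ℝ) ≤ n := by exact_mod_cast hn
  have h1 : ε ^ 4 / (L * (n : ℝ) ^ 4) ≤ ε := by
    rw [div_le_iff₀ (by positivity)]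
    calc ε ^ 4 = ε * ε ^ 3 := by ring
      _ ≤ ε * (L * n ^ 4) := mul_le_mul_of_nonneg_left hε3 hε.le
  have h2 : Real.log n ≤ (n : ℝ) * n := by
    have := log_le_self_of_nonneg (x := (n : ℝ)) (by linarith)
    nlinarith
  have h3 : 4 * L * Real.log n ≤ 4 * L * ((n : ℝ) * n) :=
    mul_le_mul_of_nonneg_left h2 (by positivity)
  have h4 : 0 < 4 * L * ((n : ℝ) * n) := by positivity
  refine ⟨by linarith, by nlinarith, ?_⟩
  rw [Real.le_log_iff_exp_le (by positivity), le_div_iff₀ hεt0]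
  have h5 := Real.exp_one_lt_d9
  have h6 : Real.exp 1 * εt ≤ 3 * εt := mul_le_mul_of_nonneg_right (by linarith) hεt0.le
  linarith

end ProxSinkhorn

theorem theorem3 :
    -- the outer iterations
    (∀ (n : ℕ), 2 ≤ n → ∀ (C : Plan n), (∀ i j, 0 ≤ C i j) →
      ∀ p ∈ stdSimplex ℝ (Fin n), ∀ q ∈ stdSimplex ℝ (Fin n),
      ∀ (L ε : ℝ), 0 < L → 0 < ε →
      ∀ (N : ℕ), 4 * L * Real.log n / ε ≤ N →
      ∀ π : ℕ → Plan n, IsProxIterates C p q L (ε / 2) N π →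
        IsEpsOptimal C p q ε (averagePlan π N)) ∧
    -- the accuracy that suffices for the inner problems
    (∃ c : ℝ, 0 < c ∧ ∃ r : ℕ, ∀ (n : ℕ), 2 ≤ n → ∀ (C : Plan n), (∀ i j, 0 ≤ C i j) →
      ∀ p ∈ stdSimplex ℝ (Fin n), ∀ q ∈ stdSimplex ℝ (Fin n),
      ∀ (L ε : ℝ), 0 < L → 0 < ε → ε ≤ 4 * L * Real.log n → ε ^ 3 ≤ L * (n : ℝ) ^ 4 →
      ∀ εt : ℝ, 0 < εt → εt ≤ c / Real.log n ^ r * (ε ^ 4 / (L * (n : ℝ) ^ 4)) →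
        -- inner problems solved by Sinkhorn's algorithm
        ((∀ i, 0 < p i) → (∀ j, 0 < q j) →
          (∀ ρ ∈ polytope p q, (∀ i j, 0 < ρ i j) →
            (∃ πhat T k, InnerSolve C L εt p q ρ πhat T k) ∧
            (∀ πhat T k, InnerSolve C L εt p q ρ πhat T k →
              (∀ i j, 0 < πhat i j) ∧
              IsResidualMin (polytope p q) (proxObjective C L ρ) εt πhat ∧
              IsInexactMin (polytope p q) (proxObjective C L ρ) (ε / 2) πhat)) ∧
          (∀ (N : ℕ), 4 * L * Real.log n / ε ≤ N →
            ∀ π : ℕ → Plan n, π 0 = productPlan p q →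
            (∀ m < N, ∃ T k, InnerSolve C L εt p q (π m) (π (m + 1)) T k) →
              IsProxIterates C p q L (ε / 2) N π ∧ IsEpsOptimal C p q ε (averagePlan π N))) ∧
        -- inner problems solved, in any way, over the plans with entries at least `ε / (4 n²)`
        (∀ (N : ℕ), 4 * L * Real.log n / ε ≤ N →
          ∀ π : ℕ → Plan n, π 0 = productPlan p q →
          (∀ m < N, IsResidualMin (truncatedPolytope p q (ε / (4 * (n : ℝ) ^ 2)))
            (proxObjective C L (π m)) εt (π (m + 1))) →
            (∀ m < N, IsInexactMin (truncatedPolytope p q (ε / (4 * (n : ℝ) ^ 2)))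
              (proxObjective C L (π m)) (ε / 2) (π (m + 1))) ∧
            IsEpsOptimal C p q ((1 + ‖C‖) * ε) (averagePlan π N))) ∧
    -- the cost of an inner solve
    (∃ A : ℝ, 0 < A ∧ ∃ r : ℕ, ∀ (n : ℕ), 2 ≤ n → ∀ (C : Plan n), (∀ i j, 0 ≤ C i j) →
      ∀ p ∈ stdSimplex ℝ (Fin n), ∀ q ∈ stdSimplex ℝ (Fin n),
      (∀ i, 0 < p i) → (∀ j, 0 < q j) →
      ∀ (L εt : ℝ), 0 < L → 0 < εt → εt < 4 * L * (n : ℝ) ^ 2 →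
      ∀ ρ ∈ polytope p q, (∀ i j, 0 < ρ i j) →
        ∃ πhat T k, InnerSolve C L εt p q ρ πhat T k ∧
          (T : ℝ) ≤ A * Real.log n ^ r * innerRate (cBar C L ρ) L εt ∧
          (k : ℝ) ≤ (n : ℝ) ^ 2 * (A * Real.log n ^ r * innerRate (cBar C L ρ) L εt)) := by
  -- No logarithmic factor is needed in the accuracy; one power of `ln n` suffices in the cost.
  refine ⟨?_, ⟨1 / 1000, by norm_num, 0, ?_⟩, ⟨54 * 4000, by norm_num, 1, ?_⟩⟩
  · intro n hn C _ p hp q hq L ε hL hε N hN π h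
    exact isEpsOptimal_averagePlan hn hp hq hL hε hN h
  · intro n hn C hC p hp q hq L ε hL hε hεL hε3 εt hεt0 hεt
    rw [pow_zero, div_one] at hεt
    obtain ⟨h1, h2, h3⟩ := accuracy_bounds hn hL hε hεL hε3 hεt0 hεt
    refine ⟨fun hp0 hq0 => ?_, fun N hN π h0 h =>
      truncated_prox_steps hn hp hq hC hL hε hεL hεt hN h0 h⟩
    have hacc : ∀ ρ : Plan n, (∀ i j, 0 < ρ i j) → ∀ πhat T k,
        InnerSolve C L εt p q ρ πhat T k → (∀ i j, 0 < πhat i j) ∧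
        IsResidualMin (polytope p q) (proxObjective C L ρ) εt πhat ∧
        IsInexactMin (polytope p q) (proxObjective C L ρ) (ε / 2) πhat := by
      intro ρ hρ πhat T k h
      obtain ⟨h4, h5, h6, h7, h8⟩ := innerSolve_accuracy hn hp hq hp0 hq0 hL hεt0 h3 hρ h
      exact ⟨h4, h5, h6, h7, fun y hy => (h8 y hy).trans h1⟩
    refine ⟨fun ρ _ hρ => ⟨?_, hacc ρ hρ⟩, fun N hN π h0 h => ?_⟩
    · obtain ⟨πhat, T, k, hrun, -⟩ := exists_innerSolve hn hC hp hq hp0 hq0 hL hεt0 h2 hρ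
      exact ⟨πhat, T, k, hrun⟩
    · have hpos : ∀ m ≤ N, ∀ i j, 0 < π m i j := by
        intro m
        induction m with
        | zero => exact fun _ i j => h0 ▸ mul_pos (hp0 i) (hq0 j)
        | succ m ih =>
          intro hm
          obtain ⟨T, k, hrun⟩ := h m hm
          exact (hacc _ (ih (by omega)) _ T k hrun).1
      have hiter : IsProxIterates C p q L (ε / 2) N π := by
        refine ⟨h0, fun m hm => ?_⟩
        obtain ⟨T, k, hrun⟩ := h m hm
        exact (hacc _ (hpos m hm.le) _ T k hrun).2.2
      exact ⟨hiter, isEpsOptimal_averagePlan hn hp hq hL hε hN hiter⟩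
  · intro n hn C hC p hp q hq hp0 hq0 L εt hL hεt hεtL ρ _ hρ
    obtain ⟨πhat, T, k, hrun, hT, hk⟩ := exists_innerSolve hn hC hp hq hp0 hq0 hL hεt hεtL hρ
    refine ⟨πhat, T, k, hrun, hT.trans ?_, hk.trans (le_of_eq (by ring))⟩
    have : 0 ≤ 4000 * Real.log n * innerRate (cBar C L ρ) L εt := (Nat.cast_nonneg T).trans hT
    rw [pow_one]
    linarith
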